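/- Let $n,m,r$ be natural numbers and let $f:\mathbb{R}^{n\times m}\to\mathbb{R}$ be twice continuously differentiable. For $\mu>0$, $U\in\mathbb{R}^{n\times r}$, $V\in\mathbb{R}^{m\times r}$ and $W=\begin{bmatrix}U\\V\end{bmatrix}\in\mathbb{R}^{(n+m)\times r}$, put $$\rho(W)=\rho(U,V)=f(UV^{\mathrm T})+\frac{\mu}{4}\,\|U^{\mathrm T}U-V^{\mathrm T}V\|_F^2 .$$ A critical point is a point where the gradient vanishes; $\lambda_{\min}$ denotes the smallest eigenvalue and $\sigma_\ell(\cdot)$ the $\ell$-th largest singular value. (1) For any $\mu>0$, every critical point $W=\begin{bmatrix}U\\V\end{bmatrix}$ of $\rho$ satisfies $U^{\mathrm T}U-V^{\mathrm T}V=0$. (2) Suppose in addition that $f$ is $(2r,4r)$-restricted strongly convex and smooth with constants $\alpha,\beta>0$, that is, $$\alpha\|G\|_F^2\le[\nabla^2f(X)](G,G)\le\beta\|G\|_F^2\quad\text{for all } X,G\in\mathbb{R}^{n\times m}\text{ with } \operatorname{rank}X\le 2r,\ \operatorname{rank}G\le 4r,$$ that $\beta/\alpha\le 1.5$, that $f$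 has a critical point $X^\star$ with $\operatorname{rank}X^\star=r^\star\le r$, and that $0<\mu\le\alpha/16$. Then: (a) $X^\star$ is the unique minimizer of $f$ over $\{X\in\mathbb{R}^{n\times m}:\operatorname{rank}X\le r\}$. (b) $\rho$ has no spurious local minima: every local minimum $W=\begin{bmatrix}U\\V\end{bmatrix}$ of $\rho$ is a global minimum of $\rho$ and satisfies $UV^{\mathrm T}=X^\star$. (c) Every critical point $W$ of $\rho$ that is not a local minimum is a strict saddle, that is, $\lambda_{\min}(\nabla^2\rho(W))<0$. Moreover, with $r^c=\operatorname{rank}W$: - if $r=r^\star$, then $\lambda_{\min}(\nabla^2\rho(W))\le-0.08\,\alpha\,\sigma_r(X^\star)$; - if $r>r^\star$ and $r^c>0$, then $\lambda_{\min}(\nabla^2\rho(W))\le-0.05\,\alpha\,\min\{\sigma_{r^c}^2(W),\,2\sigma_{r^\star}(X^\star)\}$; - if $r^c=0$, then $\lambda_{\min}(\nabla^2\rho(W))\le-0.1\,\alpha\,\sigma_{r^\star}(X^\star)$. (If $r^\star=0$, every critical point of $\rho$ is a global minimum, so (c) is empty and $\sigma_0$ is never needed.) -/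

import Mathlib

open scoped Matrix Matrix.Norms.Frobenius

noncomputable section

namespace LowRankOpt

/-- `z` is a critical point of `F`: the gradient of `F` vanishes at `z`. -/
def IsCritical {E : Type*} [NormedAddCommGroup E] [NormedSpace ℝ E] (F : E → ℝ) (z : E) : Prop :=
  fderiv ℝ F z = 0

/-- The Hessian of `F` at `z` as a bilinear form, `[∇²F(z)](a, b)`. -/
def hessForm {E : Type*} [NormedAddCommGroup E] [NormedSpace ℝ E] (F : E → ℝ) (z a b : E) : ℝ :=
  fderiv ℝ (fderiv ℝ F) z a b

/-- The Hessian of `F` at `Z` as a matrix of second partial derivatives, whose rows and columns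
are indexed by the entries of `Z`. -/
def hessMatrix {ι κ : Type*} [Fintype ι] [Fintype κ] [DecidableEq ι] [DecidableEq κ]
    (F : Matrix ι κ ℝ → ℝ) (Z : Matrix ι κ ℝ) : Matrix (ι × κ) (ι × κ) ℝ :=
  Matrix.of fun p q => hessForm F Z (Matrix.single p.1 p.2 1) (Matrix.single q.1 q.2 1)

/-- The smallest (real) eigenvalue of a square matrix. The spectrum is finite, and it is nonempty
for a symmetric matrix of positive size, so that the infimum is then attained. -/
def lambdaMin {ι : Type*} [Fintype ι] [DecidableEq ι] (H : Matrix ι ι ℝ) : ℝ :=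
  sInf (spectrum ℝ H)

/-- The `ℓ`-th largest singular value `σ_ℓ(A)`, for `ℓ ≥ 1` (the sequence in Mathlib starts at
index `0`). -/
def sigma {ι κ : Type*} [Fintype ι] [Fintype κ] [DecidableEq ι] [DecidableEq κ]
    (ℓ : ℕ) (A : Matrix ι κ ℝ) : ℝ :=
  (Matrix.toEuclideanLin A).singularValues (ℓ - 1)

/-- `(p, q)`-restricted strong convexity and smoothness with constants `α` and `β`
(`‖·‖` is the Frobenius norm). -/
def RestrictedConvexSmooth {n m : ℕ} (p q : ℕ) (α β : ℝ)
    (f : Matrix (Fin n) (Fin m) ℝ → ℝ) : Prop :=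
  ∀ X G : Matrix (Fin n) (Fin m) ℝ, X.rank ≤ p → G.rank ≤ q →
    α * ‖G‖ ^ 2 ≤ hessForm f X G G ∧ hessForm f X G G ≤ β * ‖G‖ ^ 2

/-- `X` solves the problem of minimizing `f` over all matrices of rank at most `r`. -/
def IsLowRankSolution {n m : ℕ} (f : Matrix (Fin n) (Fin m) ℝ → ℝ) (r : ℕ)
    (X : Matrix (Fin n) (Fin m) ℝ) : Prop :=
  X.rank ≤ r ∧ ∀ Y : Matrix (Fin n) (Fin m) ℝ, Y.rank ≤ r → f X ≤ f Y

/-- The regularized factored objective `ρ(W) = f(U Vᵀ) + (μ/4) ‖Uᵀ U - Vᵀ V‖_F²` as a function of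
the stacked variable `W = [U; V]`, where `U` is the upper block `W.toRows₁` and `V` is the lower
block `W.toRows₂`. -/
def rho {n m r : ℕ} (f : Matrix (Fin n) (Fin m) ℝ → ℝ) (μ : ℝ)
    (W : Matrix (Fin n ⊕ Fin m) (Fin r) ℝ) : ℝ :=
  f (W.toRows₁ * W.toRows₂ᵀ) +
    μ / 4 * ‖W.toRows₁ᵀ * W.toRows₁ - W.toRows₂ᵀ * W.toRows₂‖ ^ 2

end LowRankOpt

end

/-! Write `X = U * Vᵀ`, `E = X - Xs`, and let `G` be the gradient of `f` at `X`. A critical point of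
`rho` is balanced (`balanced_of_isCritical`), so the regularizer drops out of the first-order
conditions, leaving `Uᵀ * G = 0` and `G * V = 0`. If `X = Xs`, balancedness makes the point a global
minimum. It remains to find negative curvature when `X ≠ Xs` (`exists_negative_curvature`).

Let `g > 0` be the operator norm of `G`, with top singular pair `u, v`, and let `e` be a unit
eigenvector of `Vᵀ * V = Uᵀ * U` for its smallest eigenvalue `x`. Along `[-u * eᵀ; v * eᵀ]` the
regularizer stays zero. The second variation is the Hessian of `f` on a matrix of squared norm `2x`,
minus `2g`, hence at most `2βx - 2g`. Two lower bounds on `g` finish the argument.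

(i) `α σ ≤ g` with `σ = sigma Xs.rank Xs`: strong convexity gives `α‖E‖² ≤ -ip G Xs`, while
`sigma_mul_neg_ip_le` gives `σ * -ip G Xs ≤ g‖E‖²`, since `G` sees only the parts of `Xs` outside
the column spaces of `U` and `V`.

(ii) `3(α + β)x ≤ 2g` (`mul_le_operator_bound`): otherwise a projected gradient step from `X` lands
within `0.2‖E‖` of `Xs`, yet `norm_le_mul_norm_sub` says that a small step orthogonal to a
well-conditioned rank-`r` matrix cannot be approached so closely by a matrix of rank at most `r`.

As `β ≤ 1.5α`, (ii) yields `βx ≤ 0.4g`, so the second variation is at most `-1.2g ≤ -1.2ασ`; the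
direction has squared norm 2, whence `λ_min ≤ -0.6ασ`, stronger than every bound claimed. -/

namespace LowRankOpt

/-! ### Frobenius inner product and orthogonal projections. -/

section Frobenius

variable {ι κ l : Type*} [Fintype ι] [Fintype κ] [Fintype l]

/-- The Frobenius inner product of two real matrices. -/
def ip (A B : Matrix ι κ ℝ) : ℝ := (Aᵀ * B).trace

lemma ip_eq_sum (A B : Matrix ι κ ℝ) : ip A B = ∑ i, ∑ j, A i j * B i j := by
  simp only [ip, Matrix.trace, Matrix.diag, Matrix.mul_apply, Matrix.transpose_apply]
  exact Finset.sum_comm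

lemma ip_self (A : Matrix ι κ ℝ) : ip A A = ‖A‖ ^ 2 := by
  rw [ip_eq_sum, Matrix.frobenius_norm_def, ← Real.sqrt_eq_rpow, Real.sq_sqrt (by positivity)]
  simp [sq]

lemma ip_comm (A B : Matrix ι κ ℝ) : ip A B = ip B A := by
  simp only [ip_eq_sum, mul_comm]

lemma ip_add_right (A B C : Matrix ι κ ℝ) : ip A (B + C) = ip A B + ip A C := by
  simp [ip, Matrix.mul_add]

lemma ip_add_left (A B C : Matrix ι κ ℝ) : ip (A + B) C = ip A C + ip B C := by
  simp [ip, Matrix.add_mul]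

lemma ip_sub_right (A B C : Matrix ι κ ℝ) : ip A (B - C) = ip A B - ip A C := by
  simp [ip, Matrix.mul_sub]

lemma ip_sub_left (A B C : Matrix ι κ ℝ) : ip (A - B) C = ip A C - ip B C := by
  simp [ip, Matrix.sub_mul]

lemma ip_smul_right (c : ℝ) (A B : Matrix ι κ ℝ) : ip A (c • B) = c * ip A B := by
  simp [ip]

lemma ip_smul_left (c : ℝ) (A B : Matrix ι κ ℝ) : ip (c • A) B = c * ip A B := by
  simp [ip]

lemma ip_zero_right (A : Matrix ι κ ℝ) : ip A 0 = 0 := by simp [ip]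

lemma ip_zero_left (A : Matrix ι κ ℝ) : ip 0 A = 0 := by simp [ip]

lemma ip_transpose (A B : Matrix ι κ ℝ) : ip Aᵀ Bᵀ = ip A B := by
  simp only [ip_eq_sum, Matrix.transpose_apply]
  exact Finset.sum_comm

lemma ip_mul_left (A : Matrix ι l ℝ) (B : Matrix l κ ℝ) (C : Matrix ι κ ℝ) :
    ip (A * B) C = ip B (Aᵀ * C) := by
  simp [ip, Matrix.mul_assoc]

lemma ip_mul_right (A : Matrix ι l ℝ) (B : Matrix l κ ℝ) (C : Matrix ι κ ℝ) :
    ip (A * B) C = ip A (C * Bᵀ) := by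
  rw [ip, ip, Matrix.transpose_mul, Matrix.mul_assoc, Matrix.trace_mul_comm, Matrix.mul_assoc]

/-- Cauchy–Schwarz, from the discriminant of `t ↦ ‖A + t • B‖ ^ 2`. -/
lemma abs_ip_le (A B : Matrix ι κ ℝ) : |ip A B| ≤ ‖A‖ * ‖B‖ := by
  apply abs_le_of_sq_le_sq _ (by positivity)
  have h : ∀ t : ℝ, 0 ≤ ip B B * (t * t) + 2 * ip A B * t + ip A A := by
    intro t
    have h1 : ip (A + t • B) (A + t • B) = ip B B * (t * t) + 2 * ip A B * t + ip A A := by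
      simp only [ip_add_left, ip_add_right, ip_smul_left, ip_smul_right, ip_comm B A]
      ring
    rw [← h1, ip_self]
    positivity
  have := discrim_le_zero h
  rw [discrim, ip_self, ip_self] at this
  nlinarith

lemma ip_le (A B : Matrix ι κ ℝ) : ip A B ≤ ‖A‖ * ‖B‖ :=
  (le_abs_self _).trans (abs_ip_le A B)

lemma norm_transpose_eq (A : Matrix ι κ ℝ) : ‖Aᵀ‖ = ‖A‖ := Matrix.frobenius_norm_transpose A

lemma norm_mul_le_of_transpose_eq {P : Matrix ι ι ℝ} (hs : Pᵀ = P)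
    (hp : P * P = P) (Z : Matrix ι κ ℝ) : ‖P * Z‖ ≤ ‖Z‖ := by
  have h : ‖P * Z‖ ^ 2 ≤ ‖Z‖ * ‖P * Z‖ := by
    rw [← ip_self, ip_mul_left, hs, ← Matrix.mul_assoc, hp]
    exact ip_le _ _
  by_contra! hlt
  nlinarith [norm_nonneg Z, norm_nonneg (P * Z)]

lemma norm_mul_le_of_transpose_eq' {P : Matrix ι ι ℝ} (hs : Pᵀ = P)
    (hp : P * P = P) (Z : Matrix κ ι ℝ) : ‖Z * P‖ ≤ ‖Z‖ := by
  rw [← norm_transpose_eq, Matrix.transpose_mul, hs, ← norm_transpose_eq Z]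
  exact norm_mul_le_of_transpose_eq hs hp _

lemma one_sub_mul_self [DecidableEq ι] {P : Matrix ι ι ℝ} (hp : P * P = P) :
    (1 - P) * (1 - P) = 1 - P := by
  simp [Matrix.mul_sub, Matrix.sub_mul, hp]

lemma transpose_one_sub {ι : Type*} [DecidableEq ι] {P : Matrix ι ι ℝ} (hs : Pᵀ = P) :
    (1 - P)ᵀ = 1 - P := by
  simp [hs]

/-- Since `ip P R` is symmetric, exchanging the two projections changes the value only by the
difference of the traces. This is the dimension count behind `norm_le_mul_norm_sub`. -/
lemma norm_mul_one_sub_sq [DecidableEq ι] {P R : Matrix ι ι ℝ} (hP : Pᵀ = P) (hPp : P * P = P)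
    (hR : Rᵀ = R) (hRp : R * R = R) : ‖P * (1 - R)‖ ^ 2 = P.trace - ip P R := by
  rw [← ip_self, ip_mul_right, transpose_one_sub hR, Matrix.mul_assoc, one_sub_mul_self hRp,
    Matrix.mul_sub, Matrix.mul_one, ip_sub_right]
  congr 1
  · rw [ip, hP, hPp]
  · rw [ip_comm, ip_mul_left, hP, ip, ip, hR, hP, hPp, Matrix.trace_mul_comm]

end Frobenius

/-! ### Column-space projections and Rayleigh quotients. -/

section Projections

variable {ι κ : Type*} [Fintype ι] [Fintype κ] [DecidableEq ι]

/-- The orthogonal projection onto the column space of `A`, in the form `A * K`. -/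
lemma exists_column_projection (A : Matrix ι κ ℝ) :
    ∃ K : Matrix κ ι ℝ, (A * K)ᵀ = A * K ∧ A * K * (A * K) = A * K ∧ A * K * A = A := by
  -- The normal equations `Aᵀ * A * K = Aᵀ` are solvable because both ranges have the same
  -- dimension; then `A * K` is the projection.
  have hr : LinearMap.range (Aᵀ * A).mulVecLin = LinearMap.range Aᵀ.mulVecLin := by
    apply Submodule.eq_of_le_of_finrank_eq
    · rw [Matrix.mulVecLin_mul]
      exact LinearMap.range_comp_le_range _ _
    · change (Aᵀ * A).rank = Aᵀ.rank
      rw [Matrix.rank_transpose_mul_self, Matrix.rank_transpose]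
  have hk : ∀ i : ι, ∃ k : κ → ℝ, (Aᵀ * A) *ᵥ k = Aᵀ *ᵥ (Pi.single i 1) := by
    intro i
    have : Aᵀ.mulVecLin (Pi.single i 1) ∈ LinearMap.range (Aᵀ * A).mulVecLin := by
      rw [hr]; exact ⟨_, rfl⟩
    obtain ⟨k, hk⟩ := this
    exact ⟨k, hk⟩
  choose k hk using hk
  let K : Matrix κ ι ℝ := Matrix.of fun a i => k i a
  have hK : Aᵀ * A * K = Aᵀ := by
    ext a i
    have := congrFun (hk i) a
    rw [Matrix.mulVec_single_one] at this
    exact this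
  have h1 : (A * K)ᵀ * (A * K) = (A * K)ᵀ := by
    rw [Matrix.transpose_mul, Matrix.mul_assoc, ← Matrix.mul_assoc Aᵀ, hK]
  have hs : (A * K)ᵀ = A * K := by
    have := congrArg Matrix.transpose h1
    rw [Matrix.transpose_mul, Matrix.transpose_transpose] at this
    exact h1.symm.trans this
  refine ⟨K, hs, by rwa [hs] at h1, ?_⟩
  have := congrArg Matrix.transpose (show Aᵀ * (A * K) = Aᵀ by rw [← Matrix.mul_assoc, hK])
  rwa [Matrix.transpose_mul, Matrix.transpose_transpose, hs] at this

/-- The quadratic form of a symmetric matrix in the coordinates of an orthonormal eigenbasis. -/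
lemma ip_mul_eq_sum_eigenvalues {S : Matrix ι ι ℝ} (hS : S.IsHermitian) (Z : Matrix ι κ ℝ) :
    ip Z (S * Z) = ∑ i, ∑ j, hS.eigenvalues i *
      (((hS.eigenvectorUnitary : Matrix ι ι ℝ)ᵀ * Z) i j) ^ 2 := by
  have h : S = (hS.eigenvectorUnitary : Matrix ι ι ℝ) * Matrix.diagonal hS.eigenvalues *
      (hS.eigenvectorUnitary : Matrix ι ι ℝ)ᵀ := by
    have := hS.spectral_theorem
    rw [Unitary.conjStarAlgAut_apply] at this
    exact this
  conv_lhs => rw [h, Matrix.mul_assoc, Matrix.mul_assoc, ip_comm, ip_mul_left]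
  rw [ip_eq_sum]
  refine Finset.sum_congr rfl fun i _ => Finset.sum_congr rfl fun j _ => ?_
  rw [Matrix.diagonal_mul]
  ring

lemma eigenvectorUnitary_mul_transpose {S : Matrix ι ι ℝ} (hS : S.IsHermitian) :
    (hS.eigenvectorUnitary : Matrix ι ι ℝ) * (hS.eigenvectorUnitary : Matrix ι ι ℝ)ᵀ = 1 :=
  Unitary.coe_mul_star_self _

lemma transpose_mul_eigenvectorUnitary {S : Matrix ι ι ℝ} (hS : S.IsHermitian) :
    (hS.eigenvectorUnitary : Matrix ι ι ℝ)ᵀ * (hS.eigenvectorUnitary : Matrix ι ι ℝ) = 1 :=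
  Unitary.coe_star_mul_self hS.eigenvectorUnitary

lemma norm_sq_eq_sum_eigenvectorUnitary {S : Matrix ι ι ℝ} (hS : S.IsHermitian)
    (Z : Matrix ι κ ℝ) :
    ‖Z‖ ^ 2 = ∑ i, ∑ j, (((hS.eigenvectorUnitary : Matrix ι ι ℝ)ᵀ * Z) i j) ^ 2 := by
  have : ‖Z‖ ^ 2 = ip ((hS.eigenvectorUnitary : Matrix ι ι ℝ)ᵀ * Z)
      ((hS.eigenvectorUnitary : Matrix ι ι ℝ)ᵀ * Z) := by
    rw [ip_mul_left, Matrix.transpose_transpose, ← Matrix.mul_assoc,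
      eigenvectorUnitary_mul_transpose, Matrix.one_mul, ip_self]
  rw [this, ip_eq_sum]
  simp only [sq]

/-- A symmetric real matrix has a unit eigenvector for its largest eigenvalue. -/
lemma exists_max_eigenvector [Nonempty ι] {S : Matrix ι ι ℝ} (hS : Sᵀ = S) :
    ∃ (c : ℝ) (v : Matrix ι (Fin 1) ℝ), c ∈ spectrum ℝ S ∧ vᵀ * v = 1 ∧ S * v = c • v ∧
      ∀ {l : ℕ} (Z : Matrix ι (Fin l) ℝ), ip Z (S * Z) ≤ c * ‖Z‖ ^ 2 := by
  have hH : S.IsHermitian := hS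
  obtain ⟨i, hi⟩ := Finite.exists_max hH.eigenvalues
  refine ⟨hH.eigenvalues i, Matrix.of fun a _ => (hH.eigenvectorUnitary : Matrix ι ι ℝ) a i,
    hH.eigenvalues_mem_spectrum_real i, ?_, ?_, fun Z => ?_⟩
  · ext a b
    have := congrFun (congrFun (transpose_mul_eigenvectorUnitary hH) i) i
    rw [Matrix.mul_apply] at this ⊢
    rw [Subsingleton.elim a b, Matrix.one_apply_eq]
    rwa [Matrix.one_apply_eq] at this
  · ext a b
    exact congrFun (hH.mulVec_eigenvectorBasis i) a
  · rw [ip_mul_eq_sum_eigenvalues hH, norm_sq_eq_sum_eigenvectorUnitary hH Z, Finset.mul_sum]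
    refine Finset.sum_le_sum fun a _ => ?_
    rw [Finset.mul_sum]
    exact Finset.sum_le_sum fun b _ => mul_le_mul_of_nonneg_right (hi a) (sq_nonneg _)

/-- The smallest eigenvalue is bounded by every Rayleigh quotient. -/
lemma lambdaMin_mul_le [Nonempty ι] {H : Matrix ι ι ℝ} (hH : Hᵀ = H)
    (v : Matrix ι (Fin 1) ℝ) : lambdaMin H * ‖v‖ ^ 2 ≤ ip v (H * v) := by
  -- The largest eigenvalue `c` of `-H` puts `-c` in the spectrum of `H`.
  obtain ⟨c, w, hc, -, -, hmax⟩ := exists_max_eigenvector (S := -H) (by simp [hH])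
  have h1 : lambdaMin H ≤ -c := by
    apply csInf_le (Matrix.finite_real_spectrum (A := H)).bddBelow
    have := spectrum.neg_eq H (R := ℝ)
    rw [← Set.mem_neg, this]
    exact hc
  have h2 := hmax v
  have h3 : ip v (-H * v) = - ip v (H * v) := by simp [ip]
  nlinarith [sq_nonneg ‖v‖]

end Projections

/-! ### The smallest nonzero singular value and the row space. -/

section SingularValues

lemma rank_eq_finrank_range_toEuclideanLin {n m : ℕ} (A : Matrix (Fin n) (Fin m) ℝ) :
    Module.finrank ℝ (LinearMap.range (Matrix.toEuclideanLin A)) = A.rank := by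
  rw [A.rank_eq_finrank_range_toLin (EuclideanSpace.basisFun (Fin n) ℝ).toBasis
    (EuclideanSpace.basisFun (Fin m) ℝ).toBasis, Matrix.toEuclideanLin_eq_toLin_orthonormal]

lemma sigma_pos {n m : ℕ} {A : Matrix (Fin n) (Fin m) ℝ} (h : 0 < A.rank) :
    0 < sigma A.rank A := by
  rw [sigma, LinearMap.singularValues_pos_iff_lt_finrank_range,
    rank_eq_finrank_range_toEuclideanLin]
  omega

lemma sigma_sq_le_eigenvalues {n m : ℕ} (A : Matrix (Fin n) (Fin m) ℝ)
    (hS : (Aᵀ * A).IsHermitian) (i : Fin m) (hi : hS.eigenvalues i ≠ 0) :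
    sigma A.rank A ^ 2 ≤ hS.eigenvalues i := by
  set T := Matrix.toEuclideanLin A with hT
  have hadj : Matrix.toEuclideanLin (Aᵀ * A) = LinearMap.adjoint T ∘ₗ T := by
    rw [hT, ← Matrix.toEuclideanLin_conjTranspose_eq_adjoint,
      Matrix.conjTranspose_eq_transpose_of_trivial]
    exact Matrix.toLpLin_mul _ _ _ _ _
  -- The operator `R` is kept general so that it can be replaced by `adjoint T ∘ₗ T`, whose sorted
  -- eigenvalues are the squared singular values of `T`. The index `j` below is then found by
  -- unification.
  have key : ∀ (R : EuclideanSpace ℝ (Fin m) →ₗ[ℝ] EuclideanSpace ℝ (Fin m)) (hR : R.IsSymmetric)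
      (_ : R = LinearMap.adjoint T ∘ₗ T) (j : Fin (Fintype.card (Fin m))),
      hR.eigenvalues finrank_euclideanSpace j = T.singularValues j ^ 2 := by
    intro R hR h j
    subst h
    exact (T.sq_singularValues_fin finrank_euclideanSpace j).symm
  obtain ⟨j, hj⟩ : ∃ j : Fin (Fintype.card (Fin m)),
      hS.eigenvalues i = T.singularValues j ^ 2 :=
    ⟨_, key _ (Matrix.isSymmetric_toEuclideanLin_iff.mpr hS) hadj _⟩
  rw [hj] at hi ⊢
  have hj' : 0 < T.singularValues j := by
    rw [LinearMap.singularValues_pos_iff_ne_zero]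
    intro h0
    simp [h0] at hi
  have hlt := T.singularValues_pos_iff_lt_finrank_range.mp hj'
  rw [rank_eq_finrank_range_toEuclideanLin] at hlt
  -- A nonzero singular value has zero-based index `j < A.rank`, so `j ≤ A.rank - 1`, the index used
  -- by `sigma A.rank A`.
  exact pow_le_pow_left₀ (T.singularValues_nonneg _) (T.singularValues_antitone (by omega)) 2

/-- The orthogonal projection onto the row space of `A`, on which `A` is bounded below by its
smallest nonzero singular value. -/
lemma exists_row_projection {n m : ℕ} (A : Matrix (Fin n) (Fin m) ℝ) :
    ∃ R : Matrix (Fin m) (Fin m) ℝ, Rᵀ = R ∧ R * R = R ∧ A * R = A ∧ R.trace = A.rank ∧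
      R.rank ≤ A.rank ∧
      ∀ {l : ℕ} (Z : Matrix (Fin m) (Fin l) ℝ), sigma A.rank A * ‖R * Z‖ ≤ ‖A * Z‖ := by
  have hS : (Aᵀ * A).IsHermitian := by
    simpa using Matrix.isHermitian_conjTranspose_mul_self A
  set O := (hS.eigenvectorUnitary : Matrix (Fin m) (Fin m) ℝ) with hO
  have hO1 : O * Oᵀ = 1 := eigenvectorUnitary_mul_transpose hS
  have hO2 : Oᵀ * O = 1 := transpose_mul_eigenvectorUnitary hS
  -- `R` is the spectral projection of `Aᵀ * A` onto its nonzero eigenvalues.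
  set χ : Fin m → ℝ := fun i => if hS.eigenvalues i = 0 then 0 else 1 with hχ
  have hχχ : Matrix.diagonal χ * Matrix.diagonal χ = Matrix.diagonal χ := by
    rw [Matrix.diagonal_mul_diagonal]
    congr 1
    ext i
    simp only [hχ]
    split_ifs <;> simp
  have hcard : A.rank = Fintype.card {i // hS.eigenvalues i ≠ 0} := by
    rw [← Matrix.rank_transpose_mul_self, hS.rank_eq_card_non_zero_eigs]
  have hA : ∀ {l : ℕ} (Z : Matrix (Fin m) (Fin l) ℝ), ‖A * Z‖ ^ 2 =
      ∑ i, ∑ j, hS.eigenvalues i * ((Oᵀ * Z) i j) ^ 2 := by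
    intro l Z
    rw [← ip_mul_eq_sum_eigenvalues hS, ← ip_self, ip_mul_left, Matrix.mul_assoc]
  have hOR : Oᵀ * (O * Matrix.diagonal χ * Oᵀ) = Matrix.diagonal χ * Oᵀ := by
    rw [← Matrix.mul_assoc, ← Matrix.mul_assoc, hO2, Matrix.one_mul]
  refine ⟨O * Matrix.diagonal χ * Oᵀ, ?_, ?_, ?_, ?_, ?_, fun Z => ?_⟩
  · simp [Matrix.mul_assoc]
  · rw [Matrix.mul_assoc, hOR, ← Matrix.mul_assoc, Matrix.mul_assoc O, hχχ]
  · have h0 : ‖A * (1 - O * Matrix.diagonal χ * Oᵀ)‖ ^ 2 = 0 := by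
      rw [hA]
      refine Finset.sum_eq_zero fun i _ => Finset.sum_eq_zero fun j _ => ?_
      rw [Matrix.mul_sub, hOR, Matrix.mul_one, Matrix.sub_apply, Matrix.diagonal_mul]
      simp only [hχ]
      split_ifs with h <;> simp [h]
    have h1 := norm_eq_zero.mp (pow_eq_zero_iff two_ne_zero |>.mp h0)
    rw [Matrix.mul_sub, Matrix.mul_one, sub_eq_zero] at h1
    exact h1.symm
  · rw [Matrix.trace_mul_comm, ← Matrix.mul_assoc, hO2, Matrix.one_mul, Matrix.trace_diagonal,
      hcard, Fintype.card_subtype]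
    simp only [hχ, Finset.sum_ite, Finset.sum_const_zero, zero_add, Finset.sum_const,
      nsmul_eq_mul, mul_one, ne_eq]
  · refine (Matrix.rank_mul_le_left _ _).trans ((Matrix.rank_mul_le_right _ _).trans ?_)
    rw [Matrix.rank_diagonal, hcard]
    apply Fintype.card_le_of_injective
      (fun i : {i // χ i ≠ 0} => (⟨i.1, fun h => i.2 (by simp [hχ, h])⟩ :
        {i // hS.eigenvalues i ≠ 0}))
    intro a b hab
    simpa [Subtype.ext_iff] using hab
  · apply le_of_sq_le_sq _ (norm_nonneg _)
    rw [hA, mul_pow, norm_sq_eq_sum_eigenvectorUnitary hS, ← hO, Finset.mul_sum]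
    refine Finset.sum_le_sum fun i _ => ?_
    rw [Finset.mul_sum]
    refine Finset.sum_le_sum fun j _ => ?_
    rw [← Matrix.mul_assoc, hOR, Matrix.mul_assoc, Matrix.diagonal_mul]
    by_cases h : hS.eigenvalues i = 0
    · simp [hχ, h]
    · simp only [hχ, h, if_false, one_mul]
      exact mul_le_mul_of_nonneg_right (sigma_sq_le_eigenvalues A hS i h) (sq_nonneg _)

end SingularValues

/-! ### Two inequalities for a matrix orthogonal to the factors. -/

section CriticalPoints

variable {n m r : ℕ} {U : Matrix (Fin n) (Fin r) ℝ} {V : Matrix (Fin m) (Fin r) ℝ}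
  {G : Matrix (Fin n) (Fin m) ℝ}

/-- A matrix annihilated by the factors of `U * Vᵀ` pairs weakly with any `A` close to `U * Vᵀ`. -/
lemma sigma_mul_neg_ip_le (hUG : Uᵀ * G = 0) (hGV : G * V = 0) {g : ℝ}
    (hg : ∀ Z : Matrix (Fin m) (Fin m) ℝ, ‖G * Z‖ ≤ g * ‖Z‖) (hg0 : 0 ≤ g)
    (A : Matrix (Fin n) (Fin m) ℝ) :
    sigma A.rank A * -ip G A ≤ g * ‖U * Vᵀ - A‖ ^ 2 := by
  obtain ⟨R, hRs, hRp, hAR, -, -, hR⟩ := exists_row_projection A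
  obtain ⟨K, hPs, hPp, hPU⟩ := exists_column_projection U
  obtain ⟨L, hQs, hQp, hQV⟩ := exists_column_projection V
  have hσ : 0 ≤ sigma A.rank A := LinearMap.singularValues_nonneg _ _
  set P := U * K with hP
  set Q := V * L with hQ
  have hPG : (1 - P) * G = G := by
    have : P * G = 0 := by
      rw [← hPs, hP, Matrix.transpose_mul, Matrix.mul_assoc, hUG, Matrix.mul_zero]
    rw [Matrix.sub_mul, this, Matrix.one_mul, sub_zero]
  have hGQ : G * (1 - Q) = G := by
    rw [Matrix.mul_sub, hQ, ← Matrix.mul_assoc, hGV, Matrix.zero_mul, Matrix.mul_one, sub_zero]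
  have hVQ : Vᵀ * (1 - Q) = 0 := by
    rw [← Matrix.transpose_inj, Matrix.transpose_mul, transpose_one_sub hQs,
      Matrix.transpose_transpose, Matrix.sub_mul, hQV, Matrix.one_mul, sub_self,
      Matrix.transpose_zero]
  set E := U * Vᵀ - A with hE
  have hPE : (1 - P) * A = -((1 - P) * E) := by
    rw [hE, Matrix.mul_sub, ← Matrix.mul_assoc, Matrix.sub_mul 1 P U, hPU, Matrix.one_mul, sub_self,
      Matrix.zero_mul, zero_sub, neg_neg]
  have hEQ : A * (1 - Q) = -(E * (1 - Q)) := by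
    rw [hE, Matrix.sub_mul, Matrix.mul_assoc, hVQ, Matrix.mul_zero, zero_sub, neg_neg]
  -- `G = (1 - P) * G * (1 - Q)` and `A = A * R` split the pairing into two factors, each controlled
  -- by `E`; hence the bound is quadratic in `‖E‖`.
  have h1 : ip G A = ip (G * ((1 - Q) * R)) ((1 - P) * A) := by
    rw [← Matrix.mul_assoc, hGQ, ip_mul_right, hRs, Matrix.mul_assoc, hAR]
    nth_rw 1 [← hPG]
    rw [ip_mul_left, transpose_one_sub hPs]
  have h2 : ‖(1 - P) * A‖ ≤ ‖E‖ := by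
    rw [hPE, norm_neg]
    exact norm_mul_le_of_transpose_eq (transpose_one_sub hPs) (one_sub_mul_self hPp) E
  have h3 : ‖A * (1 - Q)‖ ≤ ‖E‖ := by
    rw [hEQ, norm_neg]
    exact norm_mul_le_of_transpose_eq' (transpose_one_sub hQs) (one_sub_mul_self hQp) E
  have h4 : sigma A.rank A * ‖(1 - Q) * R‖ ≤ ‖E‖ := by
    rw [← norm_transpose_eq, Matrix.transpose_mul, hRs, transpose_one_sub hQs]
    exact (hR _).trans h3
  have h5 : -ip G A ≤ ‖G * ((1 - Q) * R)‖ * ‖(1 - P) * A‖ := by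
    rw [h1]
    exact (neg_le_abs _).trans (abs_ip_le _ _)
  calc sigma A.rank A * -ip G A
      ≤ sigma A.rank A * ((g * ‖(1 - Q) * R‖) * ‖E‖) := by
        apply mul_le_mul_of_nonneg_left _ hσ
        exact h5.trans (mul_le_mul (hg _) h2 (norm_nonneg _) (by positivity))
    _ = g * (sigma A.rank A * ‖(1 - Q) * R‖) * ‖E‖ := by ring
    _ ≤ g * ‖E‖ * ‖E‖ := by gcongr
    _ = g * ‖E‖ ^ 2 := by ring

/-- A matrix `G` orthogonal to a well-conditioned `U * Vᵀ` of rank `r` cannot be approximated away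
by a matrix `A` of rank at most `r`. -/
lemma norm_le_mul_norm_sub (hUV : Uᵀ * U = Vᵀ * V) (hUG : Uᵀ * G = 0) (hGV : G * V = 0)
    {x c : ℝ} (hx : 0 < x) (hc : 1 ≤ c)
    (hV : ∀ {l : ℕ} (Z : Matrix (Fin r) (Fin l) ℝ), x * ‖Z‖ ^ 2 ≤ ‖V * Z‖ ^ 2)
    (hG : ∀ Z : Matrix (Fin m) (Fin m) ℝ, ‖G * Z‖ ≤ c * x * ‖Z‖)
    (A : Matrix (Fin n) (Fin m) ℝ) (hA : A.rank ≤ r) :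
    ‖G‖ ≤ c * ‖A - U * Vᵀ - G‖ := by
  obtain ⟨R, hRs, hRp, hAR, hRt, -, -⟩ := exists_row_projection A
  obtain ⟨L, hQs, hQp, hQV⟩ := exists_column_projection V
  set Q := V * L with hQ
  have hLV : L * V = 1 := by
    have h0 : V * (L * V - 1) = 0 := by
      rw [Matrix.mul_sub, ← Matrix.mul_assoc, hQV, Matrix.mul_one, sub_self]
    have h1 := hV (L * V - 1)
    rw [h0, norm_zero] at h1
    have h2 : ‖L * V - 1‖ = 0 := by
      by_contra h
      have : 0 < ‖L * V - 1‖ := lt_of_le_of_ne (norm_nonneg _) (Ne.symm h)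
      have : 0 < x * ‖L * V - 1‖ ^ 2 := by positivity
      linarith
    exact sub_eq_zero.mp (norm_eq_zero.mp h2)
  have hQt : Q.trace = r := by
    rw [hQ, Matrix.trace_mul_comm, hLV, Matrix.trace_one, Fintype.card_fin]
  have hU : ∀ {l : ℕ} (Z : Matrix (Fin r) (Fin l) ℝ), ‖U * Z‖ ^ 2 = ‖V * Z‖ ^ 2 := by
    intro l Z
    rw [← ip_self, ← ip_self, ip_mul_left, ip_mul_left, ← Matrix.mul_assoc, ← Matrix.mul_assoc, hUV]
  -- Each of the two factors of `U * Vᵀ` contributes one `x`: `U` because `‖U * Z‖ = ‖V * Z‖`, and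
  -- `Vᵀ` because it is bounded below on the column space of `V`.
  have hX : ∀ Z : Matrix (Fin m) (Fin m) ℝ, x ^ 2 * ‖Q * Z‖ ^ 2 ≤ ‖U * Vᵀ * Z‖ ^ 2 := by
    intro Z
    have h1 : x * ‖Vᵀ * Z‖ ^ 2 ≤ ‖U * Vᵀ * Z‖ ^ 2 := by
      rw [Matrix.mul_assoc, hU]
      exact hV _
    have h2 : x * ‖L * Z‖ ^ 2 ≤ ‖Q * Z‖ ^ 2 := by
      rw [hQ, Matrix.mul_assoc]
      exact hV _
    have h3 : ‖Q * Z‖ ^ 2 ≤ ‖L * Z‖ * ‖Vᵀ * Z‖ := by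
      have : ‖Q * Z‖ ^ 2 = ip (L * Z) (Vᵀ * Z) := by
        rw [← ip_self, ip_mul_left, hQs, ← Matrix.mul_assoc, hQp, ip_comm, hQ, Matrix.mul_assoc,
          ip_mul_left]
      rw [this]
      exact ip_le _ _
    have h4 : x * ‖Q * Z‖ ^ 2 ≤ ‖Vᵀ * Z‖ ^ 2 := by
      have h5 : (‖Q * Z‖ ^ 2) ^ 2 ≤ (‖L * Z‖ * ‖Vᵀ * Z‖) ^ 2 :=
        pow_le_pow_left₀ (sq_nonneg _) h3 2
      have h6 : x * (‖Q * Z‖ ^ 2) ^ 2 ≤ ‖Q * Z‖ ^ 2 * ‖Vᵀ * Z‖ ^ 2 := by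
        calc x * (‖Q * Z‖ ^ 2) ^ 2 ≤ x * (‖L * Z‖ * ‖Vᵀ * Z‖) ^ 2 := by gcongr
          _ = (x * ‖L * Z‖ ^ 2) * ‖Vᵀ * Z‖ ^ 2 := by ring
          _ ≤ _ := by gcongr
      by_contra! hlt
      have h7 : 0 < ‖Q * Z‖ ^ 2 := by
        by_contra! h
        nlinarith [sq_nonneg ‖Vᵀ * Z‖]
      nlinarith
    nlinarith
  have hR1s := transpose_one_sub hRs
  have hR1p := one_sub_mul_self hRp
  set S : Matrix (Fin m) (Fin m) ℝ := 1 - R with hS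
  -- `A` vanishes on the range of `S`, so there the error consists of all of `U * Vᵀ` and `G`, which
  -- are orthogonal to each other.
  have hbig : ‖U * Vᵀ * S‖ ^ 2 + ‖G * S‖ ^ 2 ≤ ‖A - U * Vᵀ - G‖ ^ 2 := by
    have h1 : (A - U * Vᵀ - G) * S = -(U * Vᵀ * S + G * S) := by
      have : A * S = 0 := by rw [hS, Matrix.mul_sub, hAR, Matrix.mul_one, sub_self]
      rw [Matrix.sub_mul, Matrix.sub_mul, this]
      abel
    have h2 : ‖(A - U * Vᵀ - G) * S‖ ^ 2 = ‖U * Vᵀ * S‖ ^ 2 + ‖G * S‖ ^ 2 := by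
      have h0 : ip (U * Vᵀ * S) (G * S) = 0 := by
        rw [Matrix.mul_assoc, ip_mul_left, ← Matrix.mul_assoc, hUG, Matrix.zero_mul, ip_zero_right]
      rw [h1, norm_neg, ← ip_self, ip_add_left, ip_add_right, ip_add_right, h0,
        ip_comm (G * S), h0, ip_self, ip_self]
      ring
    rw [← h2]
    exact pow_le_pow_left₀ (norm_nonneg _) (norm_mul_le_of_transpose_eq' hR1s hR1p _) 2
  have hQS : ‖Q * S‖ ^ 2 = r - ip Q R := by
    rw [← hQt]
    exact norm_mul_one_sub_sq hQs hQp hRs hRp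
  have hQR : ‖(1 - Q) * R‖ ^ 2 = A.rank - ip Q R := by
    rw [← hRt, ip_comm, ← norm_transpose_eq, Matrix.transpose_mul, hRs, transpose_one_sub hQs]
    exact norm_mul_one_sub_sq hRs hRp hQs hQp
  have hGR : ‖G * R‖ ^ 2 ≤ (c * x) ^ 2 * (A.rank - ip Q R) := by
    have h0 : G * R = G * ((1 - Q) * R) := by
      rw [← Matrix.mul_assoc, Matrix.mul_sub, hQ, ← Matrix.mul_assoc, hGV, Matrix.zero_mul,
        Matrix.mul_one, sub_zero]
    rw [h0, ← hQR, ← mul_pow]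
    exact pow_le_pow_left₀ (norm_nonneg _) (hG _) 2
  have hGs : ‖G‖ ^ 2 = ‖G * R‖ ^ 2 + ‖G * S‖ ^ 2 := by
    have h1 : G = G * R + G * S := by
      rw [hS, Matrix.mul_sub, Matrix.mul_one]; abel
    have h0 : ip (G * R) (G * S) = 0 := by
      rw [ip_mul_right, hRs, Matrix.mul_assoc, hS, Matrix.sub_mul, hRp, Matrix.one_mul, sub_self,
        Matrix.mul_zero, ip_zero_right]
    conv_lhs => rw [h1]
    rw [← ip_self, ip_add_left, ip_add_right, ip_add_right, h0,
      ip_comm (G * S), h0, ip_self, ip_self]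
    ring
  have hX1 := hX S
  rw [hQS] at hX1
  have hAr : (A.rank : ℝ) ≤ r := by exact_mod_cast hA
  apply le_of_sq_le_sq _ (by positivity)
  have hc2 : 1 ≤ c ^ 2 := by nlinarith
  -- Because `A.rank ≤ r`, the part `G * R` that `A` may capture is paid for by the part `U * Vᵀ *
  -- S` that it must miss.
  calc ‖G‖ ^ 2 ≤ (c * x) ^ 2 * (r - ip Q R) + ‖G * S‖ ^ 2 := by
        rw [hGs]
        have : (c * x) ^ 2 * (A.rank - ip Q R) ≤ (c * x) ^ 2 * (r - ip Q R) := by gcongr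
        linarith
    _ = c ^ 2 * (x ^ 2 * (r - ip Q R)) + ‖G * S‖ ^ 2 := by ring
    _ ≤ c ^ 2 * ‖U * Vᵀ * S‖ ^ 2 + c ^ 2 * ‖G * S‖ ^ 2 := by
        gcongr
        exact le_mul_of_one_le_left (sq_nonneg _) hc2
    _ = c ^ 2 * (‖U * Vᵀ * S‖ ^ 2 + ‖G * S‖ ^ 2) := by ring
    _ ≤ (c * ‖A - U * Vᵀ - G‖) ^ 2 := by
        rw [mul_pow]
        gcongr

end CriticalPoints

/-! ### Second derivatives along lines and parabolas. -/

section Calculus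

variable {E : Type*} [NormedAddCommGroup E] [NormedSpace ℝ E] {F : E → ℝ}

/-- The derivative of `F` at `z` in the direction `b`. -/
noncomputable def dirDeriv (F : E → ℝ) (z b : E) : ℝ := fderiv ℝ F z b

lemma dirDeriv_zero (F : E → ℝ) (z : E) : dirDeriv F z 0 = 0 :=
  map_zero _

lemma dirDeriv_smul (F : E → ℝ) (z b : E) (c : ℝ) : dirDeriv F z (c • b) = c * dirDeriv F z b :=
  map_smul (fderiv ℝ F z) c b

lemma dirDeriv_sum {ι : Type*} (s : Finset ι) (F : E → ℝ) (z : E) (b : ι → E) :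
    dirDeriv F z (∑ i ∈ s, b i) = ∑ i ∈ s, dirDeriv F z (b i) :=
  map_sum (fderiv ℝ F z) b s

lemma IsCritical.dirDeriv_eq_zero {z : E} (h : IsCritical F z) (b : E) : dirDeriv F z b = 0 := by
  rw [IsCritical] at h
  simp [dirDeriv, h]

lemma isCritical_of_isLocalMin {z : E} (h : IsLocalMin F z) : IsCritical F z :=
  h.fderiv_eq_zero

lemma hessForm_add_left (F : E → ℝ) (z a b c : E) :
    hessForm F z (a + b) c = hessForm F z a c + hessForm F z b c := by
  simp [hessForm]

lemma hessForm_add_right (F : E → ℝ) (z a b c : E) :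
    hessForm F z a (b + c) = hessForm F z a b + hessForm F z a c := by
  simp [hessForm]

lemma hessForm_smul_left (F : E → ℝ) (z a b : E) (c : ℝ) :
    hessForm F z (c • a) b = c * hessForm F z a b := by
  simp [hessForm]

lemma hessForm_smul_right (F : E → ℝ) (z a b : E) (c : ℝ) :
    hessForm F z a (c • b) = c * hessForm F z a b := by
  simp [hessForm]

lemma hessForm_sum_sum {ι : Type*} [Fintype ι] (F : E → ℝ) (z : E) (a : ι → E) :
    hessForm F z (∑ i, a i) (∑ i, a i) = ∑ i, ∑ j, hessForm F z (a i) (a j) := by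
  simp only [hessForm, map_sum, _root_.sum_apply]
  exact Finset.sum_comm

lemma differentiable_fderiv_of_contDiff_two (hF : ContDiff ℝ 2 F) :
    Differentiable ℝ (fderiv ℝ F) :=
  (hF.fderiv_right (m := 1) (by norm_num)).differentiable (by norm_num)

lemma hasDerivAt_quadratic (a b c : E) (t : ℝ) :
    HasDerivAt (fun t : ℝ => a + t • b + t ^ 2 • c) (b + (2 * t) • c) t := by
  have h1 : HasDerivAt (fun t : ℝ => t • b) b t := by
    simpa using (hasDerivAt_id t).smul_const b
  have h2 : HasDerivAt (fun t : ℝ => t ^ 2 • c) ((2 * t) • c) t := by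
    simpa using ((hasDerivAt_pow 2 t).smul_const c)
  exact (h1.const_add a).add h2

lemma hasDerivAt_comp_quadratic (hF : ContDiff ℝ 2 F) (a b c : E) (t : ℝ) :
    HasDerivAt (fun t : ℝ => F (a + t • b + t ^ 2 • c))
      (dirDeriv F (a + t • b + t ^ 2 • c) (b + (2 * t) • c)) t :=
  ((hF.differentiable (by norm_num) _).hasFDerivAt).comp_hasDerivAt t (hasDerivAt_quadratic a b c t)

lemma hasDerivAt_dirDeriv_comp_quadratic (hF : ContDiff ℝ 2 F) (a b c : E) :
    HasDerivAt (fun t : ℝ => dirDeriv F (a + t • b + t ^ 2 • c) (b + (2 * t) • c))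
      (hessForm F a b b + 2 * dirDeriv F a c) 0 := by
  have h1 := ((differentiable_fderiv_of_contDiff_two hF
    (a + (0 : ℝ) • b + (0 : ℝ) ^ 2 • c)).hasFDerivAt).comp_hasDerivAt 0
    (hasDerivAt_quadratic a b c 0)
  have h2 : HasDerivAt (fun t : ℝ => b + (2 * t) • c) ((2 : ℝ) • c) 0 := by
    have : HasDerivAt (fun t : ℝ => 2 * t) 2 0 := by simpa using (hasDerivAt_id (0 : ℝ)).const_mul 2
    exact (this.smul_const c).const_add b
  simpa [hessForm, dirDeriv] using h1.clm_apply h2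

lemma hessForm_comm (hF : ContDiff ℝ 2 F) (z a b : E) : hessForm F z a b = hessForm F z b a :=
  (hF.contDiffAt.isSymmSndFDerivAt (by simp)).eq a b

/-- The second variation along a parabola is the second variation along a line, if the functions
agree there. -/
lemma hessForm_eq_of_eq {E' : Type*} [NormedAddCommGroup E'] [NormedSpace ℝ E'] {F' : E' → ℝ}
    (hF : ContDiff ℝ 2 F) (hF' : ContDiff ℝ 2 F') (z d : E) (a b c : E')
    (h : ∀ t : ℝ, F (z + t • d) = F' (a + t • b + t ^ 2 • c)) :
    hessForm F z d d = hessForm F' a b b + 2 * dirDeriv F' a c := by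
  have h1 := hasDerivAt_dirDeriv_comp_quadratic hF z d 0
  have h2 := hasDerivAt_dirDeriv_comp_quadratic hF' a b c
  -- The first derivatives agree for every `t`, so they can be differentiated once more at `0`.
  have h3 : (fun t : ℝ => dirDeriv F (z + t • d + t ^ 2 • (0 : E)) (d + (2 * t) • (0 : E))) =
      fun t : ℝ => dirDeriv F' (a + t • b + t ^ 2 • c) (b + (2 * t) • c) := by
    ext t
    have h4 := hasDerivAt_comp_quadratic hF z d 0 t
    have h5 : (fun t : ℝ => F (z + t • d + t ^ 2 • (0 : E))) =
        fun t : ℝ => F' (a + t • b + t ^ 2 • c) := by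
      ext t
      simpa using h t
    rw [h5] at h4
    exact h4.unique (hasDerivAt_comp_quadratic hF' a b c t)
  rw [h3] at h1
  simpa [dirDeriv_zero] using h1.unique h2

/-- The second derivative at a local minimum is nonnegative. -/
lemma hessForm_nonneg_of_isLocalMin (hF : ContDiff ℝ 2 F) {z : E} (hz : IsLocalMin F z) (d : E) :
    0 ≤ hessForm F z d d := by
  by_contra! hneg
  set φ : ℝ → ℝ := fun t => F (z + t • d + t ^ 2 • (0 : E)) with hφ
  have hd : deriv φ = fun t : ℝ => dirDeriv F (z + t • d + t ^ 2 • (0 : E)) (d + (2 * t) • (0 : E)) :=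
    funext fun t => (hasDerivAt_comp_quadratic hF z d 0 t).deriv
  have hdd : deriv (deriv φ) 0 = hessForm F z d d := by
    rw [hd, (hasDerivAt_dirDeriv_comp_quadratic hF z d 0).deriv]
    simp [dirDeriv_zero]
  have hcont : Continuous φ :=
    hF.continuous.comp (by fun_prop)
  have hmin : IsLocalMin φ 0 := by
    have ht : Filter.Tendsto (fun t : ℝ => z + t • d + t ^ 2 • (0 : E)) (nhds 0) (nhds z) := by
      have : Continuous (fun t : ℝ => z + t • d + t ^ 2 • (0 : E)) := by fun_prop
      simpa using this.tendsto 0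
    have := ht.eventually hz
    simpa [IsLocalMin, IsMinFilter, hφ] using this
  -- Negative curvature makes the minimum also a local maximum, so `φ` is locally constant and its
  -- second derivative vanishes.
  have hmax : IsLocalMax φ 0 :=
    isLocalMax_of_deriv_deriv_neg (by rw [hdd]; exact hneg) hmin.deriv_eq_zero hcont.continuousAt
  have hconst : φ =ᶠ[nhds 0] fun _ => φ 0 := by
    filter_upwards [hmin, hmax] with t h1 h2 using le_antisymm h2 h1
  have : deriv (deriv φ) 0 = 0 := by
    rw [hconst.deriv.deriv_eq]
    simp
  linarith

/-- The mean value theorem for the derivative along a segment. -/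
lemma exists_dirDeriv_sub_eq_hessForm (hF : ContDiff ℝ 2 F) (y e b : E) :
    ∃ t ∈ Set.Ioo (0 : ℝ) 1, dirDeriv F (y + e) b - dirDeriv F y b = hessForm F (y + t • e) e b := by
  have hd : ∀ t : ℝ, HasDerivAt (fun t : ℝ => dirDeriv F (y + t • e) b)
      (hessForm F (y + t • e) e b) t := by
    intro t
    have h1 : HasDerivAt (fun t : ℝ => y + t • e) e t := by
      simpa using ((hasDerivAt_id t).smul_const e).const_add y
    have h2 := ((differentiable_fderiv_of_contDiff_two hF (y + t • e)).hasFDerivAt).comp_hasDerivAt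
      t h1
    simpa [hessForm, dirDeriv] using h2.clm_apply (hasDerivAt_const t b)
  obtain ⟨t, ht, h⟩ := exists_hasDerivAt_eq_slope _ _ (zero_lt_one' ℝ)
    (fun t _ => (hd t).continuousAt.continuousWithinAt) (fun t _ => hd t)
  exact ⟨t, ht, by rw [h]; simp⟩

lemma exists_sub_eq_dirDeriv (hF : ContDiff ℝ 2 F) (y e : E) :
    ∃ t ∈ Set.Ioo (0 : ℝ) 1, F (y + e) - F y = dirDeriv F (y + t • e) e := by
  have hd : ∀ t : ℝ, HasDerivAt (fun t : ℝ => F (y + t • e)) (dirDeriv F (y + t • e) e) t := by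
    intro t
    simpa using hasDerivAt_comp_quadratic hF y e 0 t
  obtain ⟨t, ht, h⟩ := exists_hasDerivAt_eq_slope _ _ (zero_lt_one' ℝ)
    (fun t _ => (hd t).continuousAt.continuousWithinAt) (fun t _ => hd t)
  exact ⟨t, ht, by rw [h]; simp⟩

end Calculus

/-! ### Gradients and Hessians in matrix coordinates. -/

section MatrixCalculus

variable {ι κ : Type*} [Fintype ι] [Fintype κ] [DecidableEq ι] [DecidableEq κ]

lemma contDiff_entry {ι κ : Type*} [Fintype ι] [Fintype κ] (i : ι) (j : κ) :
    ContDiff ℝ 2 (fun W : Matrix ι κ ℝ => W i j) :=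
  (LinearMap.toContinuousLinearMap (Matrix.entryLinearMap ℝ ℝ i j)).contDiff

lemma contDiff_of_entries {E : Type*} [NormedAddCommGroup E] [NormedSpace ℝ E]
    {F : E → Matrix ι κ ℝ} (h : ∀ i j, ContDiff ℝ 2 fun x => F x i j) : ContDiff ℝ 2 F := by
  have : F = fun x => ∑ i, ∑ j, F x i j • Matrix.single i j (1 : ℝ) := by
    ext1 x
    conv_lhs => rw [Matrix.matrix_eq_sum_single (F x)]
    simp
  rw [this]
  exact ContDiff.sum fun i _ => ContDiff.sum fun j _ => (h i j).smul contDiff_const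

lemma exists_gradient (F : Matrix ι κ ℝ → ℝ) (Z : Matrix ι κ ℝ) :
    ∃ G : Matrix ι κ ℝ, ∀ B, dirDeriv F Z B = ip G B := by
  refine ⟨Matrix.of fun i j => dirDeriv F Z (Matrix.single i j 1), fun B => ?_⟩
  conv_lhs => rw [Matrix.matrix_eq_sum_single B]
  have : ∀ i j, Matrix.single i j (B i j) = B i j • Matrix.single i j (1 : ℝ) := by simp
  simp only [this, dirDeriv_sum, dirDeriv_smul, ip_eq_sum, Matrix.of_apply]
  simp only [mul_comm]

lemma lambdaMin_hessMatrix_mul_le {F : Matrix ι κ ℝ → ℝ} (hF : ContDiff ℝ 2 F)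
    [Nonempty ι] [Nonempty κ] (Z D : Matrix ι κ ℝ) :
    lambdaMin (hessMatrix F Z) * ‖D‖ ^ 2 ≤ hessForm F Z D D := by
  have hs : (hessMatrix F Z)ᵀ = hessMatrix F Z := by
    ext p q
    exact hessForm_comm hF _ _ _
  have h := lambdaMin_mul_le hs (Matrix.of fun (p : ι × κ) (_ : Fin 1) => D p.1 p.2)
  have h1 : ‖(Matrix.of fun (p : ι × κ) (_ : Fin 1) => D p.1 p.2)‖ ^ 2 = ‖D‖ ^ 2 := by
    rw [← ip_self, ← ip_self, ip_eq_sum, ip_eq_sum]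
    simp [Fintype.sum_prod_type]
  have h2 : ip (Matrix.of fun (p : ι × κ) (_ : Fin 1) => D p.1 p.2)
      (hessMatrix F Z * (Matrix.of fun (p : ι × κ) (_ : Fin 1) => D p.1 p.2)) =
      hessForm F Z D D := by
    have hD : D = ∑ p : ι × κ, D p.1 p.2 • Matrix.single p.1 p.2 (1 : ℝ) := by
      conv_lhs => rw [Matrix.matrix_eq_sum_single D]
      simp [Fintype.sum_prod_type]
    have hR : hessForm F Z D D = ∑ p : ι × κ, ∑ q : ι × κ, D p.1 p.2 * (D q.1 q.2 *
        hessForm F Z (Matrix.single p.1 p.2 1) (Matrix.single q.1 q.2 1)) := by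
      conv_lhs => rw [hD]
      simp only [hessForm_sum_sum, hessForm_smul_left, hessForm_smul_right]
      exact Finset.sum_congr rfl fun p _ => Finset.sum_congr rfl fun q _ => by ring
    rw [hR, ip_eq_sum]
    refine Finset.sum_congr rfl fun p _ => ?_
    rw [Finset.univ_unique, Finset.sum_singleton, Matrix.mul_apply, Finset.mul_sum]
    exact Finset.sum_congr rfl fun q _ => by
      rw [hessMatrix, Matrix.of_apply, Matrix.of_apply, Matrix.of_apply]; ring
  rwa [h1, h2] at h

end MatrixCalculus

/-! ### The regularized objective and its balanced critical points. -/

section Rho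

variable {n m r : ℕ} {f : Matrix (Fin n) (Fin m) ℝ → ℝ}

lemma contDiff_rho (hf : ContDiff ℝ 2 f) (μ : ℝ) : ContDiff ℝ 2 (rho (r := r) f μ) := by
  have h1 : ContDiff ℝ 2 fun W : Matrix (Fin n ⊕ Fin m) (Fin r) ℝ => W.toRows₁ * W.toRows₂ᵀ := by
    apply contDiff_of_entries
    intro i j
    simp only [Matrix.mul_apply, Matrix.transpose_apply, Matrix.toRows₁_apply,
      Matrix.toRows₂_apply]
    exact ContDiff.sum fun k _ => (contDiff_entry _ _).mul (contDiff_entry _ _)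
  have h2 : ContDiff ℝ 2 fun W : Matrix (Fin n ⊕ Fin m) (Fin r) ℝ =>
      ip (W.toRows₁ᵀ * W.toRows₁ - W.toRows₂ᵀ * W.toRows₂)
        (W.toRows₁ᵀ * W.toRows₁ - W.toRows₂ᵀ * W.toRows₂) := by
    have h3 : ∀ i j, ContDiff ℝ 2 fun W : Matrix (Fin n ⊕ Fin m) (Fin r) ℝ =>
        (W.toRows₁ᵀ * W.toRows₁ - W.toRows₂ᵀ * W.toRows₂) i j := by
      intro i j
      simp only [Matrix.sub_apply, Matrix.mul_apply, Matrix.transpose_apply, Matrix.toRows₁_apply,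
        Matrix.toRows₂_apply]
      exact (ContDiff.sum fun k _ => (contDiff_entry _ _).mul (contDiff_entry _ _)).sub
        (ContDiff.sum fun k _ => (contDiff_entry _ _).mul (contDiff_entry _ _))
    simp only [ip_eq_sum]
    exact ContDiff.sum fun i _ => ContDiff.sum fun j _ => (h3 i j).mul (h3 i j)
  have : rho (r := r) f μ = fun W => f (W.toRows₁ * W.toRows₂ᵀ) + μ / 4 *
      ip (W.toRows₁ᵀ * W.toRows₁ - W.toRows₂ᵀ * W.toRows₂)
        (W.toRows₁ᵀ * W.toRows₁ - W.toRows₂ᵀ * W.toRows₂) := by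
    ext W
    rw [rho, ip_self]
  rw [this]
  exact (hf.comp h1).add (contDiff_const.mul h2)

lemma rho_add_smul (f : Matrix (Fin n) (Fin m) ℝ → ℝ) (μ : ℝ) (U A : Matrix (Fin n) (Fin r) ℝ)
    (V B : Matrix (Fin m) (Fin r) ℝ) (t : ℝ) :
    rho f μ (Matrix.fromRows U V + t • Matrix.fromRows A B) =
      f (U * Vᵀ + t • (A * Vᵀ + U * Bᵀ) + t ^ 2 • (A * Bᵀ)) + μ / 4 *
        ‖(Uᵀ * U - Vᵀ * V) + t • (Uᵀ * A + Aᵀ * U - Vᵀ * B - Bᵀ * V) +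
          t ^ 2 • (Aᵀ * A - Bᵀ * B)‖ ^ 2 := by
  have h1 : (Matrix.fromRows U V + t • Matrix.fromRows A B).toRows₁ = U + t • A := by
    ext i j; simp
  have h2 : (Matrix.fromRows U V + t • Matrix.fromRows A B).toRows₂ = V + t • B := by
    ext i j; simp
  rw [rho, h1, h2]
  congr 2
  · simp only [Matrix.transpose_add, Matrix.transpose_smul, Matrix.add_mul, Matrix.mul_add,
      Matrix.smul_mul, Matrix.mul_smul, smul_add, smul_smul, sq]
    abel
  · congr 2
    simp only [Matrix.transpose_add, Matrix.transpose_smul, Matrix.add_mul, Matrix.mul_add,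
      Matrix.smul_mul, Matrix.mul_smul, smul_add, smul_sub, smul_smul, sq]
    abel

lemma dirDeriv_rho (hf : ContDiff ℝ 2 f) (μ : ℝ) (U A : Matrix (Fin n) (Fin r) ℝ)
    (V B : Matrix (Fin m) (Fin r) ℝ) :
    dirDeriv (rho f μ) (Matrix.fromRows U V) (Matrix.fromRows A B) =
      dirDeriv f (U * Vᵀ) (A * Vᵀ + U * Bᵀ) +
        μ / 2 * ip (Uᵀ * U - Vᵀ * V) (Uᵀ * A + Aᵀ * U - Vᵀ * B - Bᵀ * V) := by
  set D₀ := Uᵀ * U - Vᵀ * V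
  set D₁ := Uᵀ * A + Aᵀ * U - Vᵀ * B - Bᵀ * V
  set D₂ := Aᵀ * A - Bᵀ * B
  have h1 := hasDerivAt_comp_quadratic (contDiff_rho (r := r) hf μ) (Matrix.fromRows U V)
    (Matrix.fromRows A B) 0 0
  have h2 := hasDerivAt_comp_quadratic hf (U * Vᵀ) (A * Vᵀ + U * Bᵀ) (A * Bᵀ) 0
  simp only [smul_zero, zero_smul, add_zero, mul_zero, ne_eq, OfNat.ofNat_ne_zero,
    not_false_eq_true, zero_pow] at h1 h2
  have hq : ∀ t : ℝ, ‖D₀ + t • D₁ + t ^ 2 • D₂‖ ^ 2 = ip D₀ D₀ + t * (2 * ip D₀ D₁) +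
      t ^ 2 * (ip D₁ D₁ + 2 * ip D₀ D₂) + t ^ 3 * (2 * ip D₁ D₂) + t ^ 4 * ip D₂ D₂ := by
    intro t
    rw [← ip_self]
    simp only [ip_add_left, ip_add_right, ip_smul_left, ip_smul_right, ip_comm D₁ D₀,
      ip_comm D₂ D₀, ip_comm D₂ D₁]
    ring
  have h3 : HasDerivAt (fun t : ℝ => ‖D₀ + t • D₁ + t ^ 2 • D₂‖ ^ 2) (2 * ip D₀ D₁) 0 := by
    simp only [hq]
    have h := ((((hasDerivAt_const (0 : ℝ) (ip D₀ D₀)).add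
      ((hasDerivAt_id (0 : ℝ)).mul_const (2 * ip D₀ D₁))).add
      ((hasDerivAt_pow 2 (0 : ℝ)).mul_const (ip D₁ D₁ + 2 * ip D₀ D₂))).add
      ((hasDerivAt_pow 3 (0 : ℝ)).mul_const (2 * ip D₁ D₂))).add
      ((hasDerivAt_pow 4 (0 : ℝ)).mul_const (ip D₂ D₂))
    refine h.congr_deriv ?_
    simp
  have h4 := h2.add (h3.const_mul (μ / 4))
  have h5 : (fun t : ℝ => rho f μ (Matrix.fromRows U V + t • Matrix.fromRows A B)) =
      (fun t : ℝ => f (U * Vᵀ + t • (A * Vᵀ + U * Bᵀ) + t ^ 2 • (A * Bᵀ))) +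
      fun t : ℝ => μ / 4 * ‖D₀ + t • D₁ + t ^ 2 • D₂‖ ^ 2 := by
    ext t
    exact rho_add_smul f μ U A V B t
  rw [h5] at h1
  rw [h1.unique h4]
  ring

/-- Critical points of the regularized objective are balanced. -/
lemma balanced_of_isCritical (hf : ContDiff ℝ 2 f) {μ : ℝ} (hμ : 0 < μ)
    {U : Matrix (Fin n) (Fin r) ℝ} {V : Matrix (Fin m) (Fin r) ℝ}
    (h : IsCritical (rho f μ) (Matrix.fromRows U V)) : Uᵀ * U - Vᵀ * V = 0 := by
  set D := Uᵀ * U - Vᵀ * V with hD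
  have hDs : Dᵀ = D := by simp [hD]
  -- The direction `(U * D, -V * D)` is chosen because it leaves `U * Vᵀ` unchanged to first order,
  -- isolating the regularizer.
  have h1 := dirDeriv_rho hf μ U (U * D) V (-(V * D))
  rw [h.dirDeriv_eq_zero] at h1
  have h2 : U * D * Vᵀ + U * (-(V * D))ᵀ = 0 := by
    simp [hDs, Matrix.mul_assoc]
  have h3 : ip D (Uᵀ * (U * D) + (U * D)ᵀ * U - Vᵀ * -(V * D) - (-(V * D))ᵀ * V) =
      2 * (‖U * D‖ ^ 2 + ‖V * D‖ ^ 2) := by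
    have e1 : ∀ {k : ℕ} (Y : Matrix (Fin k) (Fin r) ℝ), ip D (Yᵀ * (Y * D)) = ‖Y * D‖ ^ 2 := by
      intro k Y
      rw [← ip_self, ip_mul_left]
    have e2 : ∀ {k : ℕ} (Y : Matrix (Fin k) (Fin r) ℝ), ip D ((Y * D)ᵀ * Y) = ‖Y * D‖ ^ 2 := by
      intro k Y
      rw [← e1, ← ip_transpose D (Yᵀ * (Y * D)), Matrix.transpose_mul Yᵀ, Matrix.transpose_transpose,
        hDs]
    rw [Matrix.mul_neg, sub_neg_eq_add, Matrix.transpose_neg, Matrix.neg_mul, sub_neg_eq_add,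
      ip_add_right, ip_add_right, ip_add_right, e1, e2, e1, e2]
    ring
  rw [h2, h3] at h1
  simp only [dirDeriv_zero, zero_add] at h1
  have h4 : ‖U * D‖ ^ 2 + ‖V * D‖ ^ 2 = 0 := by
    rcases mul_eq_zero.mp h1.symm with h | h
    · linarith
    · linarith
  have hU : U * D = 0 := norm_eq_zero.mp (pow_eq_zero_iff two_ne_zero |>.mp
    (by nlinarith [sq_nonneg ‖U * D‖, sq_nonneg ‖V * D‖]))
  have hV : V * D = 0 := norm_eq_zero.mp (pow_eq_zero_iff two_ne_zero |>.mp
    (by nlinarith [sq_nonneg ‖U * D‖, sq_nonneg ‖V * D‖]))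
  have h5 : ‖D‖ ^ 2 = 0 := by
    rw [← ip_self, ip, hDs]
    nth_rw 1 [hD]
    rw [Matrix.sub_mul, Matrix.mul_assoc, hU, Matrix.mul_assoc, hV]
    simp
  exact norm_eq_zero.mp (pow_eq_zero_iff two_ne_zero |>.mp h5)

end Rho

/-! ### Subadditivity of rank. -/

section Rank

variable {n m : ℕ}

lemma rank_add_le_add (A B : Matrix (Fin n) (Fin m) ℝ) : (A + B).rank ≤ A.rank + B.rank := by
  have h : LinearMap.range (A + B).mulVecLin ≤
      LinearMap.range A.mulVecLin ⊔ LinearMap.range B.mulVecLin := by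
    rintro _ ⟨x, rfl⟩
    rw [Matrix.mulVecLin_add]
    exact Submodule.add_mem_sup ⟨x, rfl⟩ ⟨x, rfl⟩
  exact (Submodule.finrank_mono h).trans (Submodule.finrank_add_le_finrank_add_finrank _ _)

lemma rank_smul_le (c : ℝ) (A : Matrix (Fin n) (Fin m) ℝ) : (c • A).rank ≤ A.rank := by
  have : c • A = A * (c • (1 : Matrix (Fin m) (Fin m) ℝ)) := by simp
  rw [this]
  exact Matrix.rank_mul_le_left _ _

lemma rank_sub_le_add (A B : Matrix (Fin n) (Fin m) ℝ) : (A - B).rank ≤ A.rank + B.rank := by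
  have : A - B = A + (-1 : ℝ) • B := by simp [sub_eq_add_neg]
  rw [this]
  exact (rank_add_le_add _ _).trans (Nat.add_le_add_left (rank_smul_le _ _) _)

/-- Segments between matrices of rank at most `r` stay within rank `2r`, where the restricted
hypotheses apply. -/
lemma rank_add_smul_sub_le (A B : Matrix (Fin n) (Fin m) ℝ) (t : ℝ) :
    (A + t • (B - A)).rank ≤ A.rank + B.rank := by
  have : A + t • (B - A) = (1 - t) • A + t • B := by
    rw [smul_sub, sub_smul, one_smul]; abel
  rw [this]
  exact (rank_add_le_add _ _).trans (Nat.add_le_add (rank_smul_le _ _) (rank_smul_le _ _))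

lemma rank_mul_transpose_le {r : ℕ} (U : Matrix (Fin n) (Fin r) ℝ) (V : Matrix (Fin m) (Fin r) ℝ) :
    (U * Vᵀ).rank ≤ r :=
  (Matrix.rank_mul_le_left _ _).trans (by simpa using U.rank_le_card_width)

end Rank

/-! ### Consequences of restricted strong convexity and smoothness. -/

section Restricted

variable {n m r : ℕ} {f : Matrix (Fin n) (Fin m) ℝ → ℝ} {α β : ℝ}

/-- Restricted convexity and smoothness make the Hessian a near-isometry on low-rank matrices. -/
lemma abs_two_mul_hessForm_sub_le (hf : ContDiff ℝ 2 f)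
    (h : RestrictedConvexSmooth (2 * r) (4 * r) α β f) {Y A B : Matrix (Fin n) (Fin m) ℝ}
    (hY : Y.rank ≤ 2 * r) (hA : A.rank ≤ 2 * r) (hB : B.rank ≤ 2 * r) :
    |2 * hessForm f Y A B - (α + β) * ip A B| ≤ (β - α) * (‖A‖ * ‖B‖) := by
  -- Polarization: the upper bound at `A + t • B` minus the lower bound at `A - t • B`. The best
  -- choice is `t = ±‖A‖ / ‖B‖`.
  have key : ∀ t : ℝ, 2 * (t * (2 * hessForm f Y A B - (α + β) * ip A B)) ≤
      (β - α) * (‖A‖ ^ 2 + t ^ 2 * ‖B‖ ^ 2) := by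
    intro t
    have e1 := (h Y (A + t • B) hY ((rank_add_le_add _ _).trans
      (by have := rank_smul_le t B; omega))).2
    have e2 := (h Y (A + (-t) • B) hY ((rank_add_le_add _ _).trans
      (by have := rank_smul_le (-t) B; omega))).1
    simp only [← ip_self, ip_add_left, ip_add_right, ip_smul_left, ip_smul_right, ip_comm B A,
      hessForm_add_left, hessForm_add_right, hessForm_smul_left, hessForm_smul_right,
      hessForm_comm hf Y B A] at e1 e2 ⊢
    nlinarith
  set c := 2 * hessForm f Y A B - (α + β) * ip A B with hc
  rcases (norm_nonneg A).eq_or_lt' with hA0 | hA0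
  · have : A = 0 := norm_eq_zero.mp hA0
    subst this
    have h0 : hessForm f Y 0 B = 0 := by
      simpa using hessForm_smul_left f Y 0 B 0
    simp [hc, h0, ip_zero_left]
  rcases (norm_nonneg B).eq_or_lt' with hB0 | hB0
  · have : B = 0 := norm_eq_zero.mp hB0
    subst this
    have h0 : hessForm f Y A 0 = 0 := by
      simpa using hessForm_smul_right f Y A 0 0
    simp [hc, h0, ip_zero_right]
  have k1 := key (‖A‖ / ‖B‖)
  have k2 := key (-(‖A‖ / ‖B‖))
  have e : (‖A‖ / ‖B‖) ^ 2 * ‖B‖ ^ 2 = ‖A‖ ^ 2 := by field_simp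
  rw [neg_sq] at k2
  rw [e] at k1 k2
  have ht : 0 < ‖A‖ / ‖B‖ := by positivity
  have e2 : (β - α) * ‖A‖ ^ 2 = (‖A‖ / ‖B‖) * ((β - α) * (‖A‖ * ‖B‖)) := by field_simp
  rw [abs_le]
  constructor
  · have : (‖A‖ / ‖B‖) * (-c) ≤ (‖A‖ / ‖B‖) * ((β - α) * (‖A‖ * ‖B‖)) := by
      rw [← e2]; linarith
    linarith [le_of_mul_le_mul_left this ht]
  · have : (‖A‖ / ‖B‖) * c ≤ (‖A‖ / ‖B‖) * ((β - α) * (‖A‖ * ‖B‖)) := by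
      rw [← e2]; linarith
    exact le_of_mul_le_mul_left this ht

lemma mul_norm_sq_le_dirDeriv (hf : ContDiff ℝ 2 f)
    (h : RestrictedConvexSmooth (2 * r) (4 * r) α β f) {X Xs : Matrix (Fin n) (Fin m) ℝ}
    (hcrit : IsCritical f Xs) (hX : X.rank ≤ r) (hXs : Xs.rank ≤ r) :
    α * ‖X - Xs‖ ^ 2 ≤ dirDeriv f X (X - Xs) := by
  obtain ⟨t, -, ht⟩ := exists_dirDeriv_sub_eq_hessForm hf Xs (X - Xs) (X - Xs)
  rw [add_sub_cancel, hcrit.dirDeriv_eq_zero, sub_zero] at ht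
  rw [ht]
  refine (h _ _ ((rank_add_smul_sub_le Xs X t).trans (by omega))
    ((rank_sub_le_add X Xs).trans (by omega))).1

/-- Up to the factor `(α + β) / 2`, the gradient at `X` acts on low-rank matrices like `X - Xs`.
Thus a gradient step of length `2 / (α + β)` nearly reaches `Xs`. -/
lemma abs_two_mul_dirDeriv_sub_le (hf : ContDiff ℝ 2 f)
    (h : RestrictedConvexSmooth (2 * r) (4 * r) α β f) {X Xs B : Matrix (Fin n) (Fin m) ℝ}
    (hcrit : IsCritical f Xs) (hX : X.rank ≤ r) (hXs : Xs.rank ≤ r) (hB : B.rank ≤ 2 * r) :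
    |2 * dirDeriv f X B - (α + β) * ip (X - Xs) B| ≤ (β - α) * (‖X - Xs‖ * ‖B‖) := by
  obtain ⟨t, -, ht⟩ := exists_dirDeriv_sub_eq_hessForm hf Xs (X - Xs) B
  rw [add_sub_cancel, hcrit.dirDeriv_eq_zero, sub_zero] at ht
  rw [ht]
  exact abs_two_mul_hessForm_sub_le hf h ((rank_add_smul_sub_le Xs X t).trans (by omega))
    ((rank_sub_le_add X Xs).trans (by omega)) hB

/-- A low-rank critical point is the strict minimizer over low-rank matrices. -/
lemma lt_of_ne_of_isCritical (hf : ContDiff ℝ 2 f) (hα : 0 < α)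
    (h : RestrictedConvexSmooth (2 * r) (4 * r) α β f) {X Xs : Matrix (Fin n) (Fin m) ℝ}
    (hcrit : IsCritical f Xs) (hX : X.rank ≤ r) (hXs : Xs.rank ≤ r) (hne : X ≠ Xs) :
    f Xs < f X := by
  obtain ⟨t, ht, h1⟩ := exists_sub_eq_dirDeriv hf Xs (X - Xs)
  obtain ⟨s, hs, h2⟩ := exists_dirDeriv_sub_eq_hessForm hf Xs (t • (X - Xs)) (X - Xs)
  rw [add_sub_cancel] at h1
  rw [hcrit.dirDeriv_eq_zero, sub_zero, hessForm_smul_left, smul_smul] at h2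
  have h3 := (h _ _ ((rank_add_smul_sub_le Xs X (s * t)).trans (by omega : _ ≤ 2 * r))
    ((rank_sub_le_add X Xs).trans (by omega : _ ≤ 4 * r))).1
  have h4 : 0 < ‖X - Xs‖ := norm_pos_iff.mpr (sub_ne_zero.mpr hne)
  have h5 : 0 < α * ‖X - Xs‖ ^ 2 := by positivity
  have h6 : 0 < t * hessForm f (Xs + (s * t) • (X - Xs)) (X - Xs) (X - Xs) :=
    mul_pos ht.1 (h5.trans_le h3)
  linarith

lemma isLowRankSolution_iff (hf : ContDiff ℝ 2 f) (hα : 0 < α)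
    (h : RestrictedConvexSmooth (2 * r) (4 * r) α β f) {Xs : Matrix (Fin n) (Fin m) ℝ}
    (hcrit : IsCritical f Xs) (hXs : Xs.rank ≤ r) (X : Matrix (Fin n) (Fin m) ℝ) :
    IsLowRankSolution f r X ↔ X = Xs := by
  constructor
  · rintro ⟨hX, hmin⟩
    by_contra hne
    exact absurd (hmin Xs hXs) (not_le.mpr (lt_of_ne_of_isCritical hf hα h hcrit hX hXs hne))
  · rintro rfl
    refine ⟨hXs, fun Y hY => ?_⟩
    by_cases hYX : Y = X
    · rw [hYX]
    · exact (lt_of_ne_of_isCritical hf hα h hcrit hY hXs hYX).le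

end Restricted

/-! ### Negative curvature away from `Xs`. -/

section Saddle

variable {n m r : ℕ} {f : Matrix (Fin n) (Fin m) ℝ → ℝ} {α β μ : ℝ}
  {U : Matrix (Fin n) (Fin r) ℝ} {V : Matrix (Fin m) (Fin r) ℝ}
  {G Xs : Matrix (Fin n) (Fin m) ℝ}

/-- Balancedness removes the regularizer from the first variation; testing it with `Uᵀ * G` and `G *
V` themselves gives their squared norms. -/
lemma gradient_annihilates_factors (hf : ContDiff ℝ 2 f) (hμ : 0 < μ)
    (h : IsCritical (rho f μ) (Matrix.fromRows U V)) (hG : ∀ B, dirDeriv f (U * Vᵀ) B = ip G B) :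
    Uᵀ * G = 0 ∧ G * V = 0 := by
  have hD := balanced_of_isCritical hf hμ h
  have key : ∀ (A : Matrix (Fin n) (Fin r) ℝ) (B : Matrix (Fin m) (Fin r) ℝ),
      ip G (A * Vᵀ + U * Bᵀ) = 0 := by
    intro A B
    have h1 := dirDeriv_rho hf μ U A V B
    rw [h.dirDeriv_eq_zero, hD, ip_zero_left, hG] at h1
    linarith
  constructor
  · have h1 := key 0 (Uᵀ * G)ᵀ
    rw [Matrix.zero_mul, zero_add, Matrix.transpose_transpose, ip_comm, ip_mul_left, ip_self] at h1
    exact norm_eq_zero.mp (pow_eq_zero_iff two_ne_zero |>.mp h1)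
  · have h1 := key (G * V) 0
    rw [Matrix.transpose_zero, Matrix.mul_zero, add_zero, ip_comm, ip_mul_right,
      Matrix.transpose_transpose, ip_self] at h1
    exact norm_eq_zero.mp (pow_eq_zero_iff two_ne_zero |>.mp h1)

/-- The second variation of the regularized objective in a direction `[u; v] * eᵀ` that is
orthogonal to the factors. -/
lemma hessForm_rho_rank_one (hf : ContDiff ℝ 2 f) (hD : Uᵀ * U - Vᵀ * V = 0)
    {u : Matrix (Fin n) (Fin 1) ℝ} {v : Matrix (Fin m) (Fin 1) ℝ} {e : Matrix (Fin r) (Fin 1) ℝ}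
    (hu : uᵀ * u = 1) (hv : vᵀ * v = 1) (he : eᵀ * e = 1) (hUu : Uᵀ * u = 0) (hVv : Vᵀ * v = 0) :
    hessForm (rho f μ) (Matrix.fromRows U V) (Matrix.fromRows (u * eᵀ) (v * eᵀ))
      (Matrix.fromRows (u * eᵀ) (v * eᵀ)) =
      hessForm f (U * Vᵀ) (u * (V * e)ᵀ + U * e * vᵀ) (u * (V * e)ᵀ + U * e * vᵀ) +
        2 * dirDeriv f (U * Vᵀ) (u * vᵀ) := by
  have huU : uᵀ * U = 0 := by simpa using congrArg Matrix.transpose hUu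
  have hvV : vᵀ * V = 0 := by simpa using congrArg Matrix.transpose hVv
  apply hessForm_eq_of_eq (contDiff_rho hf μ) hf
  intro t
  rw [rho_add_smul, hD]
  -- All coefficients of `Uᵀ * U - Vᵀ * V` along the line vanish: the linear one by orthogonality,
  -- the quadratic one because `u` and `v` are both unit vectors.
  have h1 : Uᵀ * (u * eᵀ) + (u * eᵀ)ᵀ * U - Vᵀ * (v * eᵀ) - (v * eᵀ)ᵀ * V = 0 := by
    rw [← Matrix.mul_assoc, hUu, ← Matrix.mul_assoc, hVv, Matrix.transpose_mul, Matrix.transpose_mul,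
      Matrix.mul_assoc, huU, Matrix.mul_assoc, hvV]
    simp
  have h2 : (u * eᵀ)ᵀ * (u * eᵀ) - (v * eᵀ)ᵀ * (v * eᵀ) = 0 := by
    simp only [Matrix.transpose_mul, Matrix.transpose_transpose, Matrix.mul_assoc]
    rw [← Matrix.mul_assoc uᵀ, hu, ← Matrix.mul_assoc vᵀ, hv, sub_self]
  have h3 : u * eᵀ * Vᵀ + U * (v * eᵀ)ᵀ = u * (V * e)ᵀ + U * e * vᵀ := by
    simp [Matrix.mul_assoc]
  have h4 : u * eᵀ * (v * eᵀ)ᵀ = u * vᵀ := by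
    rw [Matrix.transpose_mul, Matrix.transpose_transpose, Matrix.mul_assoc, ← Matrix.mul_assoc eᵀ,
      he, Matrix.one_mul]
  rw [h1, h2, h3, h4]
  simp

lemma norm_sq_of_transpose_mul_self {ι : Type*} [Fintype ι] {u : Matrix ι (Fin 1) ℝ}
    (hu : uᵀ * u = 1) : ‖u‖ ^ 2 = 1 := by
  rw [← ip_self, ip, hu]
  simp

lemma norm_mul_transpose_sq {ι κ : Type*} [Fintype ι] [Fintype κ] (a : Matrix ι (Fin 1) ℝ)
    {b : Matrix κ (Fin 1) ℝ} (hb : bᵀ * b = 1) : ‖a * bᵀ‖ ^ 2 = ‖a‖ ^ 2 := by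
  rw [← ip_self, ip_mul_right, Matrix.transpose_transpose, Matrix.mul_assoc, hb, Matrix.mul_one,
    ip_self]

lemma norm_fromRows_sq {ι₁ ι₂ κ : Type*} [Fintype ι₁] [Fintype ι₂] [Fintype κ]
    (A : Matrix ι₁ κ ℝ) (B : Matrix ι₂ κ ℝ) :
    ‖Matrix.fromRows A B‖ ^ 2 = ‖A‖ ^ 2 + ‖B‖ ^ 2 := by
  simp only [← ip_self, ip_eq_sum, Fintype.sum_sum_type, Matrix.fromRows_apply_inl,
    Matrix.fromRows_apply_inr]

/-- A nonzero matrix has a pair of unit singular vectors realizing its operator norm. -/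
lemma exists_top_singular_pair (hG : G ≠ 0) :
    ∃ (g : ℝ) (u : Matrix (Fin n) (Fin 1) ℝ) (v : Matrix (Fin m) (Fin 1) ℝ), 0 < g ∧
      uᵀ * u = 1 ∧ vᵀ * v = 1 ∧ G * v = g • u ∧ Gᵀ * u = g • v ∧
      ∀ {l : ℕ} (Z : Matrix (Fin m) (Fin l) ℝ), ‖G * Z‖ ≤ g * ‖Z‖ := by
  have hne : Nonempty (Fin m) := by
    by_contra h
    rw [not_nonempty_iff] at h
    exact hG (by ext i j; exact h.elim j)
  obtain ⟨c, v, -, hv, hcv, hmax⟩ := exists_max_eigenvector (S := Gᵀ * G) (by simp)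
  have hmax' : ∀ {l : ℕ} (Z : Matrix (Fin m) (Fin l) ℝ), ‖G * Z‖ ^ 2 ≤ c * ‖Z‖ ^ 2 := by
    intro l Z
    have := hmax Z
    rwa [Matrix.mul_assoc, ← ip_mul_left, ip_self] at this
  have hc : 0 < c := by
    have h1 := hmax' (1 : Matrix (Fin m) (Fin m) ℝ)
    rw [Matrix.mul_one] at h1
    have h2 : 0 < ‖G‖ ^ 2 := by have := norm_pos_iff.mpr hG; positivity
    by_contra! h3
    nlinarith [sq_nonneg ‖(1 : Matrix (Fin m) (Fin m) ℝ)‖]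
  have hs : 0 < √c := Real.sqrt_pos.mpr hc
  have hss : √c * √c = c := Real.mul_self_sqrt hc.le
  refine ⟨√c, (√c)⁻¹ • (G * v), v, hs, ?_, hv, ?_, ?_, fun Z => ?_⟩
  · have h1 : (G * v)ᵀ * (G * v) = c • (1 : Matrix (Fin 1) (Fin 1) ℝ) := by
      rw [Matrix.transpose_mul, Matrix.mul_assoc, ← Matrix.mul_assoc Gᵀ, hcv, Matrix.mul_smul, hv]
    rw [Matrix.transpose_smul, Matrix.smul_mul, Matrix.mul_smul, h1, smul_smul, smul_smul]
    have : (√c)⁻¹ * (√c)⁻¹ * c = 1 := by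
      nth_rw 3 [← hss]
      field_simp
    rw [this, one_smul]
  · rw [smul_smul, mul_inv_cancel₀ hs.ne', one_smul]
  · rw [Matrix.mul_smul, ← Matrix.mul_assoc, hcv, smul_smul]
    congr 1
    nth_rw 2 [← hss]
    field_simp
  · apply le_of_sq_le_sq _ (by positivity)
    rw [mul_pow, sq √c, hss]
    exact hmax' Z

/-- The operator norm of the gradient dominates the smallest eigenvalue of the Gram matrix of the
factors, unless `U * Vᵀ = Xs`. -/
lemma mul_le_operator_bound (hf : ContDiff ℝ 2 f) (hα : 0 < α) (hβα : 2 * β ≤ 3 * α)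
    (h : RestrictedConvexSmooth (2 * r) (4 * r) α β f)
    (hcrit : IsCritical f Xs) (hXs : Xs.rank ≤ r) (hne : U * Vᵀ ≠ Xs)
    (hG : ∀ B, dirDeriv f (U * Vᵀ) B = ip G B) (hUV : Uᵀ * U = Vᵀ * V)
    (hUG : Uᵀ * G = 0) (hGV : G * V = 0) {g x : ℝ} (hx : 0 < x) (hαβ : α ≤ β)
    (hg : ∀ Z : Matrix (Fin m) (Fin m) ℝ, ‖G * Z‖ ≤ g * ‖Z‖)
    (hV : ∀ {l : ℕ} (Z : Matrix (Fin r) (Fin l) ℝ), x * ‖Z‖ ^ 2 ≤ ‖V * Z‖ ^ 2) :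
    3 * (α + β) * x ≤ 2 * g := by
  by_contra! hlt
  obtain ⟨R, hRs, hRp, hXR, -, hRr, -⟩ := exists_row_projection Xs
  -- `P` projects onto the sum of the column space of `V` and the row space of `Xs`. Truncating the
  -- gradient by it keeps the residual `B` of rank at most `2r`, while `E * P = E`.
  obtain ⟨K, hPs, hPp, hPA⟩ := exists_column_projection (Matrix.fromCols V R)
  set P := Matrix.fromCols V R * K with hP
  have hXr := rank_mul_transpose_le U V
  have hPr : P.rank ≤ 2 * r := by
    have h1 : P = V * K.toRows₁ + R * K.toRows₂ := by
      rw [hP]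
      conv_lhs => rw [← Matrix.fromRows_toRows K]
      exact Matrix.fromCols_mul_fromRows _ _ _ _
    rw [h1]
    have h2 := rank_add_le_add (V * K.toRows₁) (R * K.toRows₂)
    have h3 : (V * K.toRows₁).rank ≤ r :=
      (Matrix.rank_mul_le_left _ _).trans (by simpa using V.rank_le_card_width)
    have h4 : (R * K.toRows₂).rank ≤ R.rank := Matrix.rank_mul_le_left _ _
    omega
  rw [Matrix.mul_fromCols] at hPA
  obtain ⟨hPV, hPR⟩ := Matrix.fromCols_inj hPA
  have hVP : Vᵀ * P = Vᵀ := by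
    have := congrArg Matrix.transpose hPV
    rwa [Matrix.transpose_mul, hPs] at this
  have hRP : R * P = R := by
    have := congrArg Matrix.transpose hPR
    rwa [Matrix.transpose_mul, hPs, hRs] at this
  have hXP : Xs * P = Xs := by
    rw [← hXR, Matrix.mul_assoc, hRP]
  set E := U * Vᵀ - Xs with hE
  have hEP : E * P = E := by
    rw [hE, Matrix.sub_mul, Matrix.mul_assoc, hVP, hXP]
  have hE0 : 0 < ‖E‖ := norm_pos_iff.mpr (sub_ne_zero.mpr hne)
  have hs : 0 < α + β := by linarith
  set c := 2 / (α + β) with hc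
  have hc0 : 0 < c := by positivity
  set G₂ := (-c) • (G * P) with hG₂
  have hUG₂ : Uᵀ * G₂ = 0 := by
    rw [hG₂, Matrix.mul_smul, ← Matrix.mul_assoc, hUG, Matrix.zero_mul, smul_zero]
  have hGV₂ : G₂ * V = 0 := by
    rw [hG₂, Matrix.smul_mul, Matrix.mul_assoc, hPV, hGV, smul_zero]
  -- The contraction factor is `(β - α) / (β + α)`, at most `1/5` when `β ≤ 1.5α`.
  have hres : ‖Xs - U * Vᵀ - G₂‖ ≤ 0.2 * ‖E‖ := by
    set B := Xs - U * Vᵀ - G₂ with hB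
    have hBE : B = c • (G * P) - E := by
      rw [hB, hG₂, hE, neg_smul]; abel
    have hBP : B * P = B := by
      rw [hBE, Matrix.sub_mul, Matrix.smul_mul, Matrix.mul_assoc, hPp, hEP]
    have hBr : B.rank ≤ 2 * r := by
      rw [← hBP]
      exact (Matrix.rank_mul_le_right _ _).trans hPr
    have h1 := abs_two_mul_dirDeriv_sub_le hf h hcrit hXr hXs hBr
    rw [hG, ← hE] at h1
    have h2 : ip (G * P) B = ip G B := by
      rw [ip_mul_right, hPs, hBP]
    have h3 : (α + β) * ‖B‖ ^ 2 = 2 * ip G B - (α + β) * ip E B := by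
      rw [← ip_self]
      nth_rw 1 [hBE]
      rw [ip_sub_left, ip_smul_left, h2, hc]
      field_simp
    rw [← h3] at h1
    have h4 : (α + β) * ‖B‖ ^ 2 ≤ (β - α) * (‖E‖ * ‖B‖) := (le_abs_self _).trans h1
    by_contra! h5
    have h6 : 0 < ‖B‖ := by linarith
    have h7 : (α + β) * ‖B‖ ≤ (β - α) * ‖E‖ := by
      apply le_of_mul_le_mul_right _ h6
      linarith
    nlinarith
  -- The negated claim says `c * g < 3 * x`, which supplies the constant 3. Together with `hres` it
  -- gives `‖E‖ ≤ (1 + 3) * 0.2 * ‖E‖`, a contradiction.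
  have hbound : ‖G₂‖ ≤ 3 * ‖Xs - U * Vᵀ - G₂‖ := by
    refine norm_le_mul_norm_sub hUV hUG₂ hGV₂ hx (by norm_num) hV (fun Z => ?_) Xs hXs
    have h1 : ‖G₂ * Z‖ = c * ‖G * (P * Z)‖ := by
      rw [hG₂, Matrix.smul_mul, Matrix.mul_assoc, norm_smul, norm_neg, Real.norm_of_nonneg hc0.le]
    have h2 : ‖P * Z‖ ≤ ‖Z‖ := norm_mul_le_of_transpose_eq hPs hPp Z
    have h3 : c * g ≤ 3 * x := by
      rw [hc, div_mul_eq_mul_div, div_le_iff₀ hs]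
      linarith
    have hg0 : ‖G * (P * Z)‖ ≤ (3 * x / c) * ‖P * Z‖ := by
      refine (hg _).trans (mul_le_mul_of_nonneg_right ?_ (norm_nonneg _))
      rw [le_div_iff₀ hc0]
      linarith
    rw [h1]
    calc c * ‖G * (P * Z)‖ ≤ c * ((3 * x / c) * ‖P * Z‖) := by gcongr
      _ = 3 * x * ‖P * Z‖ := by field_simp
      _ ≤ 3 * x * ‖Z‖ := by gcongr
  have h1 : ‖E‖ ≤ ‖Xs - U * Vᵀ - G₂‖ + ‖G₂‖ := by
    have : E = -((Xs - U * Vᵀ - G₂) + G₂) := by rw [hE]; abel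
    rw [this, norm_neg]
    exact norm_add_le _ _
  linarith

/-- At a critical point whose product is not `Xs` there is a direction of negative curvature. -/
lemma exists_negative_curvature (hf : ContDiff ℝ 2 f) (hμ : 0 < μ) (hα : 0 < α)
    (hβα : 2 * β ≤ 3 * α) (h : RestrictedConvexSmooth (2 * r) (4 * r) α β f)
    (hcrit : IsCritical f Xs) (hXs : Xs.rank ≤ r)
    (hW : IsCritical (rho f μ) (Matrix.fromRows U V)) (hne : U * Vᵀ ≠ Xs) :
    0 < Xs.rank ∧ ∃ D : Matrix (Fin n ⊕ Fin m) (Fin r) ℝ, ‖D‖ ^ 2 = 2 ∧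
      hessForm (rho f μ) (Matrix.fromRows U V) D D ≤ 2 * (-0.6 * α * sigma Xs.rank Xs) := by
  obtain ⟨G, hG⟩ := exists_gradient f (U * Vᵀ)
  obtain ⟨hUG, hGV⟩ := gradient_annihilates_factors hf hμ hW hG
  have hD := balanced_of_isCritical hf hμ hW
  have hUV : Uᵀ * U = Vᵀ * V := sub_eq_zero.mp hD
  have hXr := rank_mul_transpose_le U V
  have hE0 : 0 < ‖U * Vᵀ - Xs‖ := norm_pos_iff.mpr (sub_ne_zero.mpr hne)
  have hE2 : 0 < ‖U * Vᵀ - Xs‖ ^ 2 := by positivity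
  have hlow : α * ‖U * Vᵀ - Xs‖ ^ 2 ≤ -ip G Xs := by
    have h1 := mul_norm_sq_le_dirDeriv hf h hcrit hXr hXs
    rw [hG, ip_sub_right, ip_comm G (U * Vᵀ), ip_mul_left, hUG, ip_zero_right] at h1
    linarith
  have hpos : 0 < α * ‖U * Vᵀ - Xs‖ ^ 2 := by positivity
  have hG0 : G ≠ 0 := by
    rintro rfl
    rw [ip_zero_left] at hlow
    linarith
  have hrank : 0 < Xs.rank := by
    -- If `Xs = 0`, then `ip G Xs = 0` contradicts `hlow`; so for rank zero there is no critical
    -- point with `U * Vᵀ ≠ Xs`.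
    by_contra! h0
    have : Xs = 0 := by
      obtain ⟨R, hRs, hRp, hXR, hRt, -, -⟩ := exists_row_projection Xs
      have h1 : ‖R‖ ^ 2 = 0 := by
        rw [← ip_self, ip, hRs, hRp, hRt]
        exact_mod_cast Nat.le_zero.mp h0
      rw [← hXR, norm_eq_zero.mp (pow_eq_zero_iff two_ne_zero |>.mp h1), Matrix.mul_zero]
    rw [this, ip_zero_right] at hlow
    rw [this] at hpos
    linarith
  refine ⟨hrank, ?_⟩
  have hr : 0 < r := hrank.trans_le hXs
  have : Nonempty (Fin r) := ⟨⟨0, hr⟩⟩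
  obtain ⟨g, u, v, hg, hu, hv, hGv, hGu, hgmax⟩ := exists_top_singular_pair hG0
  -- The top eigenvector of `-(Vᵀ * V)` is the unit vector `e` minimizing `‖V * e‖`.
  obtain ⟨y, e, -, he, hye, hymax⟩ := exists_max_eigenvector (S := -(Vᵀ * V)) (by simp)
  obtain ⟨x, rfl⟩ : ∃ x, y = -x := ⟨-y, by ring⟩
  have hVmin : ∀ {l : ℕ} (Z : Matrix (Fin r) (Fin l) ℝ), x * ‖Z‖ ^ 2 ≤ ‖V * Z‖ ^ 2 := by
    intro l Z
    have h1 := hymax Z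
    have h2 : ip Z (-(Vᵀ * V) * Z) = -‖V * Z‖ ^ 2 := by
      rw [← ip_self, ip_mul_left, ← Matrix.mul_assoc]
      simp [ip]
    rw [h2] at h1
    linarith
  have hVe : ‖V * e‖ ^ 2 = x := by
    have h1 : Vᵀ * (V * e) = x • e := by
      rw [← Matrix.mul_assoc, ← neg_inj, ← Matrix.neg_mul, hye, neg_smul]
    rw [← ip_self, ip_mul_left, h1, ip_smul_right, ip_self, norm_sq_of_transpose_mul_self he,
      mul_one]
  have hUe : ‖U * e‖ ^ 2 = x := by
    rw [← hVe, ← ip_self, ← ip_self, ip_mul_left, ip_mul_left, ← Matrix.mul_assoc,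
      ← Matrix.mul_assoc, hUV]
  have hx0 : 0 ≤ x := hVe ▸ sq_nonneg _
  have hu' : (-u)ᵀ * (-u) = 1 := by simp [hu]
  have hUu : Uᵀ * u = 0 := by
    have h1 : g • (Uᵀ * u) = 0 := by
      rw [← Matrix.mul_smul, ← hGv, ← Matrix.mul_assoc, hUG, Matrix.zero_mul]
    exact (smul_eq_zero.mp h1).resolve_left hg.ne'
  have hVv : Vᵀ * v = 0 := by
    have h1 : g • (Vᵀ * v) = 0 := by
      rw [← Matrix.mul_smul, ← hGu, ← Matrix.mul_assoc, ← Matrix.transpose_mul, hGV]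
      simp
    exact (smul_eq_zero.mp h1).resolve_left hg.ne'
  have hUu' : Uᵀ * (-u) = 0 := by rw [Matrix.mul_neg, hUu, neg_zero]
  -- The sign of `u` makes the gradient term `2 * ip G (-u * vᵀ) = -2g`.
  refine ⟨Matrix.fromRows (-u * eᵀ) (v * eᵀ), ?_, ?_⟩
  · rw [norm_fromRows_sq, norm_mul_transpose_sq _ he, norm_mul_transpose_sq _ he,
      norm_sq_of_transpose_mul_self hu', norm_sq_of_transpose_mul_self hv]
    norm_num
  rw [hessForm_rho_rank_one hf hD hu' hv he hUu' hVv, hG]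
  have hGuv : ip G (-u * vᵀ) = -g := by
    rw [ip_comm, ip_mul_right, Matrix.transpose_transpose, hGv, ip_smul_right]
    have : ip (-u) u = -1 := by
      have := norm_sq_of_transpose_mul_self hu
      rw [← ip_self] at this
      rw [← this]
      simp [ip]
    rw [this]
    ring
  set T := -u * (V * e)ᵀ + U * e * vᵀ with hT
  have hTn : ‖T‖ ^ 2 = 2 * x := by
    have h0 : ip (-u * (V * e)ᵀ) (U * e * vᵀ) = 0 := by
      rw [ip_comm, Matrix.mul_assoc U, ip_mul_left, ← Matrix.mul_assoc, hUu', Matrix.zero_mul,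
        ip_zero_right]
    have h1 : ‖-u * (V * e)ᵀ‖ ^ 2 = x := by
      rw [← norm_transpose_eq, Matrix.transpose_mul, Matrix.transpose_transpose,
        norm_mul_transpose_sq _ hu', hVe]
    have h2 : ‖U * e * vᵀ‖ ^ 2 = x := by
      rw [norm_mul_transpose_sq _ hv, hUe]
    rw [← ip_self, hT, ip_add_left, ip_add_right, ip_add_right, ip_comm (U * e * vᵀ), h0, ip_self,
      ip_self, h1, h2]
    ring
  have hTr : T.rank ≤ 4 * r := by
    have h1 : T.rank ≤ _ := rank_add_le_add (-u * (V * e)ᵀ) (U * e * vᵀ)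
    have h2 := rank_mul_transpose_le (-u) (V * e)
    have h3 := rank_mul_transpose_le (U * e) v
    omega
  have hTle := (h (U * Vᵀ) T (hXr.trans (by omega)) hTr).2
  have hαβ : α ≤ β := by
    have h1 := h (U * Vᵀ) (U * Vᵀ - Xs) (hXr.trans (by omega))
      ((rank_sub_le_add _ _).trans (by omega))
    exact le_of_mul_le_mul_right (h1.1.trans h1.2) hE2
  have hgs : α * sigma Xs.rank Xs ≤ g := by
    have h1 := sigma_mul_neg_ip_le hUG hGV hgmax hg.le Xs
    have h2 : sigma Xs.rank Xs * (α * ‖U * Vᵀ - Xs‖ ^ 2) ≤ sigma Xs.rank Xs * -ip G Xs :=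
      mul_le_mul_of_nonneg_left hlow (sigma_pos hrank).le
    apply le_of_mul_le_mul_right _ hE2
    linarith
  have hgx : 3 * (α + β) * x ≤ 2 * g := by
    rcases hx0.eq_or_lt with h0 | h0
    · rw [← h0]
      linarith
    · exact mul_le_operator_bound hf hα hβα h hcrit hXs hne hG hUV hUG hGV h0 hαβ hgmax hVmin
  rw [hTn] at hTle
  rw [hGuv]
  -- Hence `2βx - 2g ≤ -1.2g`, and `hgs` turns this into the stated bound.
  have hβx : β * x ≤ 0.4 * g := by
    have : 5 * β ≤ 3 * (α + β) := by linarith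
    nlinarith
  linarith

lemma rho_le_of_mul_eq (hf : ContDiff ℝ 2 f) (hμ : 0 < μ) (hα : 0 < α)
    (h : RestrictedConvexSmooth (2 * r) (4 * r) α β f)
    (hcrit : IsCritical f Xs) (hXs : Xs.rank ≤ r) (hD : Uᵀ * U - Vᵀ * V = 0)
    (hUV : U * Vᵀ = Xs) (W : Matrix (Fin n ⊕ Fin m) (Fin r) ℝ) :
    rho f μ (Matrix.fromRows U V) ≤ rho f μ W := by
  have h1 := ((isLowRankSolution_iff hf hα h hcrit hXs Xs).mpr rfl).2 (W.toRows₁ * W.toRows₂ᵀ)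
    (rank_mul_transpose_le _ _)
  rw [rho, rho, Matrix.toRows₁_fromRows, Matrix.toRows₂_fromRows, hD, hUV, norm_zero]
  have h2 : 0 ≤ μ / 4 * ‖W.toRows₁ᵀ * W.toRows₁ - W.toRows₂ᵀ * W.toRows₂‖ ^ 2 := by positivity
  linarith

end Saddle

end LowRankOpt

/-! ### Deduction of the theorem. -/

theorem theorem3 {n m r : ℕ} (f : Matrix (Fin n) (Fin m) ℝ → ℝ) (hf : ContDiff ℝ 2 f)
    (μ : ℝ) (hμ : 0 < μ) :
    (∀ (U : Matrix (Fin n) (Fin r) ℝ) (V : Matrix (Fin m) (Fin r) ℝ),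
      LowRankOpt.IsCritical (LowRankOpt.rho f μ) (Matrix.fromRows U V) →
        Uᵀ * U - Vᵀ * V = 0) ∧
    ∀ (α β : ℝ), 0 < α → 0 < β →
      LowRankOpt.RestrictedConvexSmooth (2 * r) (4 * r) α β f → β / α ≤ 1.5 →
      ∀ (Xs : Matrix (Fin n) (Fin m) ℝ) (rs : ℕ), LowRankOpt.IsCritical f Xs →
        Xs.rank = rs → rs ≤ r → μ ≤ α / 16 →
        -- `Xs` is the unique solution of the rank-constrained problem
        (∀ X, LowRankOpt.IsLowRankSolution f r X ↔ X = Xs) ∧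
        -- no spurious local minima
        (∀ (U : Matrix (Fin n) (Fin r) ℝ) (V : Matrix (Fin m) (Fin r) ℝ),
          IsLocalMin (LowRankOpt.rho f μ) (Matrix.fromRows U V) →
            (∀ W : Matrix (Fin n ⊕ Fin m) (Fin r) ℝ,
              LowRankOpt.rho f μ (Matrix.fromRows U V) ≤ LowRankOpt.rho f μ W) ∧
            U * Vᵀ = Xs) ∧
        -- every other critical point is a strict saddle, with explicit bounds
        (∀ W : Matrix (Fin n ⊕ Fin m) (Fin r) ℝ,
          LowRankOpt.IsCritical (LowRankOpt.rho f μ) W →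
          ¬ IsLocalMin (LowRankOpt.rho f μ) W →
            LowRankOpt.lambdaMin (LowRankOpt.hessMatrix (LowRankOpt.rho f μ) W) < 0 ∧
            (r = rs →
              LowRankOpt.lambdaMin (LowRankOpt.hessMatrix (LowRankOpt.rho f μ) W)
                ≤ -0.08 * α * LowRankOpt.sigma r Xs) ∧
            (rs < r → 0 < W.rank →
              LowRankOpt.lambdaMin (LowRankOpt.hessMatrix (LowRankOpt.rho f μ) W)
                ≤ -0.05 * α *
                  min (LowRankOpt.sigma W.rank W ^ 2) (2 * LowRankOpt.sigma rs Xs)) ∧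
            (W.rank = 0 →
              LowRankOpt.lambdaMin (LowRankOpt.hessMatrix (LowRankOpt.rho f μ) W)
                ≤ -0.1 * α * LowRankOpt.sigma rs Xs)) := by
  refine ⟨fun U V h => LowRankOpt.balanced_of_isCritical hf hμ h, ?_⟩
  intro α β hα _ hRCS hβα Xs rs hcrit hrank hrs _
  subst hrank
  have hβα' : 2 * β ≤ 3 * α := by
    rw [div_le_iff₀ hα] at hβα
    linarith
  refine ⟨LowRankOpt.isLowRankSolution_iff hf hα hRCS hcrit hrs, fun U V hmin => ?_,
    fun W hW hnot => ?_⟩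
  · have hW := LowRankOpt.isCritical_of_isLocalMin hmin
    have hUV : U * Vᵀ = Xs := by
      by_contra hne
      obtain ⟨hpos, D, -, hneg⟩ :=
        LowRankOpt.exists_negative_curvature hf hμ hα hβα' hRCS hcrit hrs hW hne
      have h1 := LowRankOpt.hessForm_nonneg_of_isLocalMin (LowRankOpt.contDiff_rho hf μ) hmin D
      have h2 := mul_pos hα (LowRankOpt.sigma_pos hpos)
      linarith
    exact ⟨LowRankOpt.rho_le_of_mul_eq hf hμ hα hRCS hcrit hrs
      (LowRankOpt.balanced_of_isCritical hf hμ hW) hUV, hUV⟩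
  · obtain ⟨U, V, rfl⟩ : ∃ U V, W = Matrix.fromRows U V :=
      ⟨W.toRows₁, W.toRows₂, (Matrix.fromRows_toRows W).symm⟩
    have hne : U * Vᵀ ≠ Xs := fun hUV => hnot (Filter.Eventually.of_forall
      (LowRankOpt.rho_le_of_mul_eq hf hμ hα hRCS hcrit hrs
        (LowRankOpt.balanced_of_isCritical hf hμ hW) hUV))
    obtain ⟨hpos, D, hD, hneg⟩ :=
      LowRankOpt.exists_negative_curvature hf hμ hα hβα' hRCS hcrit hrs hW hne
    have hr : Nonempty (Fin r) := ⟨⟨0, hpos.trans_le hrs⟩⟩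
    have hn : Nonempty (Fin n ⊕ Fin m) := by
      by_contra hempty
      rw [not_nonempty_iff] at hempty
      have : D = 0 := by ext i; exact hempty.elim i
      simp [this] at hD
    have hl := LowRankOpt.lambdaMin_hessMatrix_mul_le (LowRankOpt.contDiff_rho hf μ)
      (Matrix.fromRows U V) D
    rw [hD] at hl
    have hs := mul_pos hα (LowRankOpt.sigma_pos hpos)
    -- All four bounds follow from `λ_min ≤ -0.6ασ`; in the case `rs < r` the minimum is bounded by
    -- its second term, which suffices since `0.05 * 2 ≤ 0.6`.
    refine ⟨by linarith, fun hr => ?_, fun _ _ => ?_, fun _ => by linarith⟩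
    · have : LowRankOpt.sigma r Xs = LowRankOpt.sigma Xs.rank Xs :=
        congrArg (LowRankOpt.sigma · Xs) hr
      rw [this]
      linarith
    · have hmin := mul_le_mul_of_nonneg_left (min_le_right
        (LowRankOpt.sigma (Matrix.fromRows U V).rank (Matrix.fromRows U V) ^ 2)
        (2 * LowRankOpt.sigma Xs.rank Xs)) hα.le
      linarith
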